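/- Consider the parametric mathematical program with complementarity constraints (MPCC) $$\min_{w\in\mathbb R^n} f(w,p)\quad\text{s.t.}\quad h(w,p)=0,\quad g(w,p)\le 0,\quad 0\le G(w,p)\perp H(w,p)\ge 0,$$ with $p\in\mathbb R^{n_p}$ and $f,h,g,G,H$ twice continuously differentiable in $(w,p)$, with values in $\mathbb R,\mathbb R^{m_h},\mathbb R^{m_g},\mathbb R^m,\mathbb R^m$. For feasible $w$ let $\mathcal I_{0+}(w),\mathcal I_{+0}(w),\mathcal I_{00}(w)$ be the sets of indices $i$ with $G_i=0<H_i$, $G_i>0=H_i$, $G_i=H_i=0$ (the last ones are called degenerate), and $\mathcal P(w,p)=\{\mathcal I_{0+}(w)\cup\mathcal J:\mathcal J\subseteq\mathcal I_{00}(w)\}$. For $\mathcal I\subseteq\{1,\dots,m\}$ the branch problem $\mathrm{BNLP}_{\mathcal I}(p)$ replaces the complementarity constraints by $G_i=0,\ H_i\ge0$ $(i\in\mathcal I)$ and $G_i\ge0,\ H_i=0$ $(i\notin\mathcal I)$; its Lagrangian is $\mathcal L=f+\lambda^\top h+\mu^\top g-\xi^\top G-\nu^\top H$, and $z=(w,\lambda,\mu,\xi,\nu)$.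 A feasible $w$ is B-stationary if it is a KKT point of $\mathrm{BNLP}_{\mathcal I}(p)$ for every $\mathcal I\in\mathcal P(w,p)$; $z$ is S-stationary if it satisfies the KKT conditions of the relaxed problem, i.e. $w$ is feasible, $\nabla_w\mathcal L=0$, $0\le\mu\perp -g\ge 0$, $\nu_i=0$ on $\mathcal I_{0+}$, $\xi_i=0$ on $\mathcal I_{+0}$, and $\xi_i,\nu_i\ge0$ on $\mathcal I_{00}$. MPCC-LICQ is linear independence of the $w$-gradients of all $h_i$ and of all those $g_i,G_i,H_i$ that vanish at the point. MPCC-SSOSC at $w$ means that there are multipliers making $z$ S-stationary with $d^\top\nabla^2_{ww}\mathcal L\,d>0$ for all $d\ne0$ in the union over $\mathcal I\in\mathcal P(w,p)$ of the strong critical cones of $\mathrm{BNLP}_{\mathcal I}(p)$ (the tangent space of the equality constraints and of the active inequality constraints with positive multiplier). A map is $\mathrm{PC}^1$ near a point if on a neighborhood of it the map is continuous and a selection of finitely many $C^1$ maps. Let $\bar w$ be B-stationary for $\bar p$, with MPCC-LICQ and MPCC-SSOSC at $(\bar w,\bar p)$. Let $v\in\mathbb R^{n_p}$, $p(\tau)=\bar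 p+\tau v$ and $\mathcal S_T=\{p(\tau):\tau\in[0,T]\}$. Let $\mathcal I\in\mathcal P(\bar w,\bar p)$, and let $z^{\mathcal I}=(w^{\mathcal I},\lambda^{\mathcal I},\mu^{\mathcal I},\xi^{\mathcal I},\nu^{\mathcal I})$ be a solution map of $\mathrm{BNLP}_{\mathcal I}$ with $w^{\mathcal I}(\bar p)=\bar w$ on an open set $U\supseteq\mathcal S_1$, i.e. $z^{\mathcal I}$ is continuous on $U$ and, for each $p\in U$, $z^{\mathcal I}(p)$ is a KKT point of $\mathrm{BNLP}_{\mathcal I}(p)$ at which LICQ and SSOSC of this problem hold. Let either $i\in\mathcal I_{0+}(\bar w)$ and $\theta=\xi_i^{\mathcal I}$, or $i\in\mathcal I_{+0}(\bar w)$ and $\theta=\nu_i^{\mathcal I}$. Suppose that this index becomes degenerate at $\tau_s\in(0,1)$: $i\notin\mathcal I_{00}(w^{\mathcal I}(p(\tau)))$ for $\tau\in[0,\tau_s)$ and $i\in\mathcal I_{00}(w^{\mathcal I}(p(\tau)))$ for $\tau\in[\tau_s,1]$; put $p_s=p(\tau_s)$. Say that no other pair interferes at $p$ if $\xi^{\mathcal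 I}_j(p),\nu^{\mathcal I}_j(p)\ge0$ for all $j\ne i$ with $j\in\mathcal I_{00}(w^{\mathcal I}(p))$ (for instance, if all pairs $j\neq i$ are nondegenerate). Then: (a) If no other pair interferes on $\mathcal S_1$ and $\theta(p(\tau))\ge0$ for all $\tau\in[\tau_s,1]$, then $z^{\mathcal I}$ is $\mathrm{PC}^1$ near every $p\in\mathcal S_1$, and $w^{\mathcal I}(p)$ is B-stationary for every $p\in\mathcal S_1$. (b) If $\theta(p_s)<0$, then $w^{\mathcal I}(p(\tau))$ is not B-stationary for any $\tau\in[\tau_s,1]$ with $\theta(p(\tau))<0$; in particular, for all $T>\tau_s$ sufficiently close to $\tau_s$, it is not B-stationary for any $\tau\in[\tau_s,T]$. Moreover, if no other pair interferes at $p(\tau)$ for $\tau\in[0,\tau_s)$, and if $\hat w$ is a B-stationary point for $p_s$ satisfying MPCC-LICQ and MPCC-SSOSC, then for all $T>\tau_s$ sufficiently close to $\tau_s$ there is a map $z(\cdot)=(w,\lambda,\mu,\xi,\nu)(\cdot)$ on $\mathcal S_T$ such that $w(p)$ is B-stationary and $z(p)$ is S-stationary for every $p\in\mathcal S_T$, $z=z^{\mathcal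 I}$ at $p(\tau)$ for $\tau\in[0,\tau_s)$, $w(p_s)=\hat w$, and both $z$ and $w$ are discontinuous at $p_s$. If no other pair interferes on $\mathcal S_1$ and $\theta(p_s)\ne0$, then for all $T>\tau_s$ sufficiently close to $\tau_s$ exactly one of the following occurs: $z^{\mathcal I}$ is $\mathrm{PC}^1$ near, and $w^{\mathcal I}$ is B-stationary at, every point of $\mathcal S_T$; or $w^{\mathcal I}(p(\tau))$ is not B-stationary for any $\tau\in[\tau_s,T]$. -/

import Mathlib

open Set Filter Topology

/-- `ℝⁿ` with the Euclidean norm. -/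
abbrev Vec (n : ℕ) := EuclideanSpace ℝ (Fin n)

/-- Primal-dual vectors `z = (w, λ, μ, ξ, ν)`. -/
abbrev PrimalDual (n mh mg m : ℕ) := Vec n × Vec mh × Vec mg × Vec m × Vec m

namespace PrimalDual

variable {n mh mg m : ℕ}

/-- The primal component `w`. -/
def w (z : PrimalDual n mh mg m) : Vec n := z.1

/-- The multiplier `λ` of `h(w,p) = 0`. -/
def lam (z : PrimalDual n mh mg m) : Vec mh := z.2.1

/-- The multiplier `μ` of `g(w,p) ≤ 0`. -/
def mu (z : PrimalDual n mh mg m) : Vec mg := z.2.2.1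

/-- The multiplier `ξ` belonging to `G`. -/
def xi (z : PrimalDual n mh mg m) : Vec m := z.2.2.2.1

/-- The multiplier `ν` belonging to `H`. -/
def nu (z : PrimalDual n mh mg m) : Vec m := z.2.2.2.2

end PrimalDual

/-- A parametric mathematical program with complementarity constraints
`min_w f(w,p)  s.t.  h(w,p) = 0,  g(w,p) ≤ 0,  0 ≤ G(w,p) ⟂ H(w,p) ≥ 0`
with twice continuously differentiable data (the variable is the pair `(w, p)`). -/
structure ParamMPCC (n np mh mg m : ℕ) where
  f : Vec n × Vec np → ℝ
  h : Fin mh → Vec n × Vec np → ℝ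
  g : Fin mg → Vec n × Vec np → ℝ
  G : Fin m → Vec n × Vec np → ℝ
  H : Fin m → Vec n × Vec np → ℝ
  contDiff_f : ContDiff ℝ 2 f
  contDiff_h : ∀ i, ContDiff ℝ 2 (h i)
  contDiff_g : ∀ i, ContDiff ℝ 2 (g i)
  contDiff_G : ∀ i, ContDiff ℝ 2 (G i)
  contDiff_H : ∀ i, ContDiff ℝ 2 (H i)

namespace ParamMPCC

variable {n np mh mg m : ℕ} (Q : ParamMPCC n np mh mg m)

/-- The feasible set for the parameter `p`. -/
def Feasible (w : Vec n) (p : Vec np) : Prop :=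
  (∀ i, Q.h i (w, p) = 0) ∧ (∀ i, Q.g i (w, p) ≤ 0) ∧
    ∀ i, 0 ≤ Q.G i (w, p) ∧ 0 ≤ Q.H i (w, p) ∧ Q.G i (w, p) * Q.H i (w, p) = 0

/-- The index set `𝓘₀₊`. -/
def I0p (w : Vec n) (p : Vec np) : Set (Fin m) := {i | Q.G i (w, p) = 0 ∧ 0 < Q.H i (w, p)}

/-- The index set `𝓘₊₀`. -/
def Ip0 (w : Vec n) (p : Vec np) : Set (Fin m) := {i | 0 < Q.G i (w, p) ∧ Q.H i (w, p) = 0}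

/-- The degenerate indices `𝓘₀₀`. -/
def I00 (w : Vec n) (p : Vec np) : Set (Fin m) := {i | Q.G i (w, p) = 0 ∧ Q.H i (w, p) = 0}

/-- The active inequality constraints `𝓐`. -/
def active (w : Vec n) (p : Vec np) : Set (Fin mg) := {i | Q.g i (w, p) = 0}

/-- The family `𝓟(w, p)` of branch index sets `𝓘 = 𝓘₀₊ ∪ 𝓘'` with `𝓘' ⊆ 𝓘₀₀`. -/
def branches (w : Vec n) (p : Vec np) : Set (Set (Fin m)) :=
  {I | ∃ J ⊆ Q.I00 w p, I = Q.I0p w p ∪ J}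

/-- The partial derivative `∇_w φ(w,p)`, as a linear form on `ℝⁿ`. -/
noncomputable def dw (φ : Vec n × Vec np → ℝ) (w : Vec n) (p : Vec np) : Vec n →L[ℝ] ℝ :=
  fderiv ℝ (fun x => φ (x, p)) w

/-- The MPCC Lagrangian as a function of `w`; the multipliers are those of `z`. -/
noncomputable def lagrangian (z : PrimalDual n mh mg m) (p : Vec np) (w : Vec n) : ℝ :=
  Q.f (w, p) + ∑ i, z.lam i * Q.h i (w, p) + ∑ i, z.mu i * Q.g i (w, p)
    - ∑ i, z.xi i * Q.G i (w, p) - ∑ i, z.nu i * Q.H i (w, p)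

/-- The quadratic form `dᵀ ∇²_{ww} 𝓛(z,p) d`. -/
noncomputable def hessForm (z : PrimalDual n mh mg m) (p : Vec np) (d : Vec n) : ℝ :=
  fderiv ℝ (fderiv ℝ (Q.lagrangian z p)) z.w d d

/-- Linear independence of the gradients of all `h i`, of `g i` for `i ∈ A`, of `G i` for
`i ∈ K` and of `H i` for `i ∈ L`. -/
def GradientsIndependent (w : Vec n) (p : Vec np) (A : Set (Fin mg)) (K L : Set (Fin m)) : Prop :=
  LinearIndependent ℝ
    (Sum.elim (fun i : Fin mh => dw (Q.h i) w p)
      (Sum.elim (fun i : A => dw (Q.g i) w p)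
        (Sum.elim (fun i : K => dw (Q.G i) w p) (fun i : L => dw (Q.H i) w p))))

/-- MPCC-LICQ: the LICQ of the relaxed NLP at `w`. Its active constraints are `h`, the active
`g i`, `G i` for `i ∈ 𝓘₀₊ ∪ 𝓘₀₀`, and `H i` for `i ∈ 𝓘₊₀ ∪ 𝓘₀₀`. -/
def MPCCLICQ (w : Vec n) (p : Vec np) : Prop :=
  Q.GradientsIndependent w p (Q.active w p) (Q.I0p w p ∪ Q.I00 w p) (Q.Ip0 w p ∪ Q.I00 w p)

/-- `z` is a KKT point of the branch NLP
`min_w f(w,p)  s.t.  h = 0,  g ≤ 0,  G_i = 0, H_i ≥ 0 (i ∈ I),  G_i ≥ 0, H_i = 0 (i ∉ I)`. -/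
def BranchKKT (I : Set (Fin m)) (z : PrimalDual n mh mg m) (p : Vec np) : Prop :=
  fderiv ℝ (Q.lagrangian z p) z.w = 0 ∧
  (∀ i, Q.h i (z.w, p) = 0) ∧
  (∀ i, 0 ≤ z.mu i ∧ Q.g i (z.w, p) ≤ 0 ∧ z.mu i * Q.g i (z.w, p) = 0) ∧
  (∀ i ∈ I, Q.G i (z.w, p) = 0 ∧
    0 ≤ Q.H i (z.w, p) ∧ 0 ≤ z.nu i ∧ z.nu i * Q.H i (z.w, p) = 0) ∧
  (∀ i ∉ I, Q.H i (z.w, p) = 0 ∧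
    0 ≤ Q.G i (z.w, p) ∧ 0 ≤ z.xi i ∧ z.xi i * Q.G i (z.w, p) = 0)

/-- LICQ of the branch NLP `I` at `w`: besides the equality constraints `h`, `G i` (`i ∈ I`) and
`H i` (`i ∉ I`), those inequality constraints count that are active. -/
def BranchLICQ (I : Set (Fin m)) (w : Vec n) (p : Vec np) : Prop :=
  Q.GradientsIndependent w p (Q.active w p)
    (I ∪ {i | i ∉ I ∧ Q.G i (w, p) = 0}) (Iᶜ ∪ {i | i ∈ I ∧ Q.H i (w, p) = 0})

/-- The strong critical cone of the branch NLP `I` at `z`. -/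
def strongCone (I : Set (Fin m)) (z : PrimalDual n mh mg m) (p : Vec np) : Set (Vec n) :=
  {d | (∀ i, dw (Q.h i) z.w p d = 0) ∧
    (∀ i ∈ Q.active z.w p, 0 < z.mu i → dw (Q.g i) z.w p d = 0) ∧
    (∀ i, i ∈ I ∨ (i ∉ I ∧ 0 < z.xi i) → dw (Q.G i) z.w p d = 0) ∧
    (∀ i, i ∉ I ∨ (i ∈ I ∧ 0 < z.nu i) → dw (Q.H i) z.w p d = 0)}

/-- The second-order inequality of the SSOSC of the branch NLP `I` at `z`. -/
def BranchSSOSC (I : Set (Fin m)) (z : PrimalDual n mh mg m) (p : Vec np) : Prop :=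
  ∀ d ∈ Q.strongCone I z p, d ≠ 0 → 0 < Q.hessForm z p d

/-- B-stationarity: `w` is a stationary point of every branch NLP `I ∈ 𝓟(w,p)`; the
multipliers may depend on the branch. -/
def BStationary (w : Vec n) (p : Vec np) : Prop :=
  Q.Feasible w p ∧
    ∀ I ∈ Q.branches w p, ∃ z : PrimalDual n mh mg m, z.w = w ∧ Q.BranchKKT I z p

/-- S-stationarity of `z.w` with the MPCC multipliers `(λ, μ, ξ, ν)` of `z`. -/
def SStationary (z : PrimalDual n mh mg m) (p : Vec np) : Prop :=
  Q.Feasible z.w p ∧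
  fderiv ℝ (Q.lagrangian z p) z.w = 0 ∧
  (∀ i, 0 ≤ z.mu i ∧ z.mu i * Q.g i (z.w, p) = 0) ∧
  (∀ i ∈ Q.I0p z.w p, z.nu i = 0) ∧
  (∀ i ∈ Q.Ip0 z.w p, z.xi i = 0) ∧
  (∀ i ∈ Q.I00 z.w p, 0 ≤ z.xi i ∧ 0 ≤ z.nu i)

/-- The strong MPCC critical cone: the union of the strong critical cones of the branch NLPs. -/
def strongMPCCCone (z : PrimalDual n mh mg m) (p : Vec np) : Set (Vec n) :=
  ⋃ I ∈ Q.branches z.w p, Q.strongCone I z p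

/-- MPCC-SSOSC at `w`. -/
def MPCCSSOSC (w : Vec n) (p : Vec np) : Prop :=
  ∃ z : PrimalDual n mh mg m, z.w = w ∧ Q.SStationary z p ∧
    ∀ d ∈ Q.strongMPCCCone z p, d ≠ 0 → 0 < Q.hessForm z p d

/-- `z` is a solution map on `U` of the branch NLP `I`: it is continuous and each `z p` is a
KKT point of the branch NLP with parameter `p` at which LICQ and SSOSC hold (so that `(z p).w` is
an isolated local minimizer with unique multipliers). -/
def BranchSolutionMap (I : Set (Fin m)) (U : Set (Vec np))
    (z : Vec np → PrimalDual n mh mg m) : Prop :=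
  ContinuousOn z U ∧
    ∀ p ∈ U, Q.BranchKKT I (z p) p ∧ Q.BranchLICQ I (z p).w p ∧ Q.BranchSSOSC I (z p) p

/-- For all parameters `p ∈ S`, no index pair other than `i` violates the sign conditions of
S-stationarity at `z p`: every degenerate pair `j ≠ i` has nonnegative multipliers.
In particular this holds if, on `S`, all pairs `j ≠ i` are nondegenerate. -/
def OtherPairsSigned (i : Fin m) (S : Set (Vec np)) (z : Vec np → PrimalDual n mh mg m) : Prop :=
  ∀ p ∈ S, ∀ j ∈ Q.I00 (z p).w p, j ≠ i → 0 ≤ (z p).xi j ∧ 0 ≤ (z p).nu j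

end ParamMPCC

/-- `z` is piecewise continuously differentiable near `p`: on an open neighborhood of `p` it is
continuous and a selection of finitely many `C¹` functions. -/
def PC1At {E F : Type*} [NormedAddCommGroup E] [NormedSpace ℝ E] [NormedAddCommGroup F]
    [NormedSpace ℝ F] (z : E → F) (p : E) : Prop :=
  ∃ V : Set E, IsOpen V ∧ p ∈ V ∧ ContinuousOn z V ∧
    ∃ (N : ℕ) (φ : Fin N → E → F), (∀ k, ContDiffOn ℝ 1 (φ k) V) ∧ ∀ q ∈ V, ∃ k, z q = φ k q

/-- The segment `𝓢(p, p + T v) = {p + τ v : τ ∈ [0, T]}`. -/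
def paramSegment {E : Type*} [AddCommGroup E] [Module ℝ E] (p v : E) (T : ℝ) : Set E :=
  (fun τ : ℝ => p + τ • v) '' Set.Icc 0 T

/-!
In a branch problem each pair contributes one equality constraint. By LICQ, the branch problems
through a point share their multipliers, so that a KKT point of one of them is B-stationary if and
only if the equality constraints of its degenerate pairs have nonnegative multipliers. When a single
pair becomes degenerate along a branch solution map, the sign of its multiplier therefore decides
whether B-stationarity survives.

The solution map is `PC¹` because its KKT points solve, for one of finitely many working sets, a
square system of equations that LICQ and SSOSC make regular. When the multiplier is negative, the
prescribed point `ŵ` is a strict local minimizer of the MPCC, so for nearby parameters there are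
local minimizers close to it; these inherit LICQ, hence are S-stationary, and replace the branch
solution from the switch on. The primal solution jumps, because `ŵ` is B-stationary and the limit
along the branch is not.
-/

/-! ### Differential calculus -/

section Calculus

variable {E F κ : Type*} [NormedAddCommGroup E] [NormedSpace ℝ E] [NormedAddCommGroup F]
  [NormedSpace ℝ F]

theorem surjective_pi_of_linearIndependent [Finite κ] {c' : κ → E →L[ℝ] ℝ}
    (h : LinearIndependent ℝ c') : Function.Surjective (ContinuousLinearMap.pi c') := by
  classical
  have := Fintype.ofFinite κ
  by_contra hne
  obtain ⟨Λ, hΛ, hker⟩ := Submodule.exists_le_ker_of_lt_top _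
    (lt_top_iff_ne_top.2 fun h => hne (LinearMap.range_eq_top.1 h))
  have hsum : ∑ k, Λ (fun j => if k = j then 1 else 0) • c' k = 0 := by
    ext x
    have hx : Λ (ContinuousLinearMap.pi c' x) = 0 := hker ⟨x, rfl⟩
    rw [LinearMap.pi_apply_eq_sum_univ Λ] at hx
    simpa [mul_comm] using hx
  refine hΛ (LinearMap.ext fun y => ?_)
  simp [LinearMap.pi_apply_eq_sum_univ Λ y, Fintype.linearIndependent_iff.1 h _ hsum]

theorem hasFDerivAt_fderiv {φ : E → F} (hφ : ContDiff ℝ 2 φ) (x : E) :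
    HasFDerivAt (fderiv ℝ φ) (fderiv ℝ (fderiv ℝ φ) x) x :=
  ((hφ.fderiv_right (m := 1) le_rfl).differentiable one_ne_zero x).hasFDerivAt

/-- Lyusternik's theorem. The curve is `t ↦ x + t • d + R (ψ t)` for a right inverse `R` of `Φ'`,
where `ψ` is given by the implicit function theorem. -/
theorem exists_hasDerivAt_curve_of_surjective [CompleteSpace E] [FiniteDimensional ℝ F]
    {Φ : E → F} {Φ' : E →L[ℝ] F} {x : E} (hΦ : HasStrictFDerivAt Φ Φ' x)
    (hsurj : Function.Surjective Φ') (d : E) :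
    ∃ γ : ℝ → E, γ 0 = x ∧ HasDerivAt γ d 0 ∧ ∀ᶠ t in 𝓝 0, Φ (γ t) = Φ x + t • Φ' d := by
  have : CompleteSpace F := FiniteDimensional.complete ℝ F
  obtain ⟨R, hR⟩ := Φ'.exists_rightInverse_of_surjective (LinearMap.range_eq_top.2 hsurj)
  have hRΦ : ∀ y, Φ' (R y) = y := fun y => DFunLike.congr_fun hR y
  let F₀ : ℝ × F → F := fun u => Φ (x + u.1 • d + R u.2) - u.1 • Φ' d
  have hF₀ : HasStrictFDerivAt F₀ (ContinuousLinearMap.snd ℝ ℝ F) ((0, 0) : ℝ × F) := by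
    have hlin : HasStrictFDerivAt (fun u : ℝ × F => u.1 • d)
        ((ContinuousLinearMap.fst ℝ ℝ F).smulRight d) (0, 0) :=
      ((ContinuousLinearMap.fst ℝ ℝ F).smulRight d).hasStrictFDerivAt
    have hcorr : HasStrictFDerivAt (fun u : ℝ × F => u.1 • Φ' d)
        ((ContinuousLinearMap.fst ℝ ℝ F).smulRight (Φ' d)) (0, 0) :=
      ((ContinuousLinearMap.fst ℝ ℝ F).smulRight (Φ' d)).hasStrictFDerivAt
    have hinner := (hlin.const_add x).add
      (R.hasStrictFDerivAt.comp ((0, 0) : ℝ × F) hasStrictFDerivAt_snd)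
    have houter := (HasStrictFDerivAt.comp ((0, 0) : ℝ × F) (by simpa using hΦ) hinner).sub hcorr
    refine houter.congr_fderiv ?_
    ext <;> simp [hRΦ]
  have hinv : (ContinuousLinearMap.snd ℝ ℝ F ∘L .inr ℝ ℝ F).IsInvertible := by
    rw [ContinuousLinearMap.snd_comp_inr]
    exact ⟨.refl ℝ F, rfl⟩
  let ψ := hF₀.implicitFunctionOfProdDomain hinv
  have hψ : HasDerivAt ψ 0 0 := by
    have h := (hF₀.hasStrictFDerivAt_implicitFunctionOfProdDomain hinv).hasFDerivAt.hasDerivAt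
    simpa using h
  have hψ0 : ψ 0 = 0 := tendsto_nhds_unique hψ.continuousAt
    (hF₀.tendsto_implicitFunctionOfProdDomain hinv)
  refine ⟨fun t => x + t • d + R (ψ t), by simp [hψ0], ?_, ?_⟩
  · simpa using (((hasDerivAt_id (0 : ℝ)).smul_const d).const_add x).fun_add
      (R.hasFDerivAt.comp_hasDerivAt (0 : ℝ) hψ)
  · filter_upwards [hF₀.eventually_apply_implicitFunctionOfProdDomain hinv] with t ht
    simpa [F₀, sub_eq_iff_eq_add] using ht

theorem tendsto_inv_norm_mul_sub {φ : E → ℝ} {φ' : E →L[ℝ] ℝ} {x d : E} {l : Filter E}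
    (hφ : HasFDerivAt φ φ' x) (hl : l ≤ 𝓝 x)
    (hd : Tendsto (fun y => ‖y - x‖⁻¹ • (y - x)) l (𝓝 d)) :
    Tendsto (fun y => ‖y - x‖⁻¹ * (φ y - φ x)) l (𝓝 (φ' d)) := by
  have hrem : Tendsto (fun y => ‖y - x‖⁻¹ * (φ y - φ x - φ' (y - x))) l (𝓝 0) := by
    rw [tendsto_zero_iff_norm_tendsto_zero]
    refine ((hasFDerivAt_iff_tendsto.1 hφ).mono_left hl).congr fun y => ?_
    rw [norm_mul, norm_inv, norm_norm]
  have hlin : Tendsto (fun y => φ' (‖y - x‖⁻¹ • (y - x))) l (𝓝 (φ' d)) :=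
    (φ'.continuous.tendsto d).comp hd
  refine (zero_add (φ' d) ▸ hrem.add hlin).congr fun y => ?_
  rw [map_smul, smul_eq_mul]
  ring

/-- The mean value theorem on the segment from `x` to `x + u` reduces the claim to the derivative of
`L` along `u`, which is within `ε ‖u‖ ^ 2` of the quadratic form. -/
theorem eventually_fderiv_fderiv_apply_le {L : E → ℝ} {x : E}
    (hL : Differentiable ℝ L) (hL' : DifferentiableAt ℝ (fderiv ℝ L) x)
    (h0 : fderiv ℝ L x = 0) {ε : ℝ} (hε : 0 < ε) :
    ∀ᶠ y in 𝓝 x, L y ≤ L x →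
      fderiv ℝ (fderiv ℝ L) x (y - x) (y - x) ≤ ε * ‖y - x‖ ^ 2 := by
  obtain ⟨δ, hδ, hball⟩ := Metric.eventually_nhds_iff.1 (hL'.hasFDerivAt.isLittleO.def hε)
  filter_upwards [Metric.ball_mem_nhds x hδ] with y hyδ hy
  set u := y - x with hu
  have hder : ∀ t : ℝ, HasDerivAt (fun t : ℝ => L (x + t • u)) (fderiv ℝ L (x + t • u) u) t :=
    fun t => (hL _).hasFDerivAt.comp_hasDerivAt t
      (by simpa using ((hasDerivAt_id t).smul_const u).const_add x)
  obtain ⟨t, ht, hslope⟩ := exists_hasDerivAt_eq_slope _ _ one_pos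
    (fun t _ => (hder t).continuousAt.continuousWithinAt) fun t _ => hder t
  have hneg : fderiv ℝ L (x + t • u) u ≤ 0 := by
    rw [hslope]
    simpa [hu] using hy
  have happrox : ‖fderiv ℝ L (x + t • u) - t • fderiv ℝ (fderiv ℝ L) x u‖ ≤ ε * (t * ‖u‖) := by
    have hdist : dist (x + t • u) x < δ := by
      rw [dist_eq_norm, add_sub_cancel_left, norm_smul, Real.norm_of_nonneg ht.1.le]
      exact (mul_le_of_le_one_left (norm_nonneg u) ht.2.le).trans_lt (mem_ball_iff_norm.1 hyδ)
    simpa [h0, norm_smul, abs_of_pos ht.1] using hball hdist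
  have hquad : t * fderiv ℝ (fderiv ℝ L) x u u ≤ t * (ε * ‖u‖ ^ 2) := by
    have hle := (abs_le.1 ((ContinuousLinearMap.le_opNorm _ u).trans
      (mul_le_mul_of_nonneg_right happrox (norm_nonneg u)))).1
    simp only [sub_apply, smul_apply, smul_eq_mul] at hle
    linarith
  exact le_of_mul_le_mul_left hquad ht.1

theorem fderiv_fderiv_apply_nonpos_of_tendsto {L : E → ℝ} {x d : E} {l : Filter E} [NeBot l]
    (hL : Differentiable ℝ L) (hL' : DifferentiableAt ℝ (fderiv ℝ L) x)
    (h0 : fderiv ℝ L x = 0) (hl : l ≤ 𝓝[≠] x) (hle : ∀ᶠ y in l, L y ≤ L x)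
    (hd : Tendsto (fun y => ‖y - x‖⁻¹ • (y - x)) l (𝓝 d)) :
    fderiv ℝ (fderiv ℝ L) x d d ≤ 0 := by
  set A := fderiv ℝ (fderiv ℝ L) x
  refine le_of_forall_pos_le_add fun ε hε => ?_
  have hlim : Tendsto (fun y => A (‖y - x‖⁻¹ • (y - x)) (‖y - x‖⁻¹ • (y - x))) l (𝓝 (A d d)) :=
    ((by fun_prop : Continuous fun e => A e e).tendsto d).comp hd
  refine le_of_tendsto hlim ?_
  filter_upwards [hle, hl self_mem_nhdsWithin, hl.trans nhdsWithin_le_nhds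
    (eventually_fderiv_fderiv_apply_le hL hL' h0 hε)] with y hy hne hquad
  have hpos : 0 < ‖y - x‖ := norm_pos_iff.2 (sub_ne_zero.2 hne)
  calc A (‖y - x‖⁻¹ • (y - x)) (‖y - x‖⁻¹ • (y - x))
      = (‖y - x‖ ^ 2)⁻¹ * A (y - x) (y - x) := by
        simp only [map_smul, smul_apply, smul_eq_mul]
        ring
    _ ≤ (‖y - x‖ ^ 2)⁻¹ * (ε * ‖y - x‖ ^ 2) := by gcongr; exact hquad hy
    _ = 0 + ε := by field_simp; simp

theorem exists_ultrafilter_tendsto_direction [FiniteDimensional ℝ E] {X : Set E} {x : E}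
    (hX : ∃ᶠ y in 𝓝 x, y ∈ X ∧ y ≠ x) :
    ∃ (u : Ultrafilter E) (d : E), (u : Filter E) ≤ 𝓝[≠] x ∧ X ∈ u ∧ d ≠ 0 ∧
      Tendsto (fun y => ‖y - x‖⁻¹ • (y - x)) u (𝓝 d) := by
  have : NeBot (𝓝[X ∩ {x}ᶜ] x) := mem_closure_iff_nhdsWithin_neBot.1
    (mem_closure_iff_frequently.2 hX)
  let u := Ultrafilter.of (𝓝[X ∩ {x}ᶜ] x)
  have hle : (u : Filter E) ≤ 𝓝[X ∩ {x}ᶜ] x := Ultrafilter.of_le _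
  have hmem : X ∩ {x}ᶜ ∈ u := hle self_mem_nhdsWithin
  have : ProperSpace E := FiniteDimensional.proper ℝ E
  have hsphere : ∀ᶠ y in (u : Filter E), ‖y - x‖⁻¹ • (y - x) ∈ Metric.sphere (0 : E) 1 := by
    filter_upwards [hmem] with y hy
    simpa [norm_smul] using inv_mul_cancel₀ (norm_ne_zero_iff.2 (sub_ne_zero.2 hy.2))
  obtain ⟨d, hdS, hd⟩ := (isCompact_sphere (0 : E) 1).ultrafilter_le_nhds
    (u.map fun y => ‖y - x‖⁻¹ • (y - x)) (le_principal_iff.2 hsphere)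
  exact ⟨u, d, hle.trans (nhdsWithin_mono x inter_subset_right),
    mem_of_superset hmem inter_subset_left, Metric.ne_of_mem_sphere hdS one_ne_zero, hd⟩

end Calculus

/-! ### Nonlinear programs -/

/-- The nonlinear program of minimizing `obj` subject to `con k = 0` for `k ∈ eqs` and `con k ≥ 0`
for `k ∉ eqs`. A single family of constraints allows for a single vector of multipliers, whose sign
is restricted only outside `eqs`. -/
structure NLP (E κ : Type*) where
  obj : E → ℝ
  con : κ → E → ℝ
  eqs : Set κ

namespace NLP

section Defs

variable {E κ : Type*} [NormedAddCommGroup E] [NormedSpace ℝ E] [Fintype κ] (P : NLP E κ)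

/-- The feasible set of a nonlinear program. -/
def feasible : Set E := {x | (∀ k, 0 ≤ P.con k x) ∧ ∀ k ∈ P.eqs, P.con k x = 0}

/-- The Lagrangian of a nonlinear program, with multipliers `y`. The constraints enter with a minus
sign, so that the multipliers of the inequality constraints `con k ≥ 0` are nonnegative. -/
def lagrangian (y : κ → ℝ) (x : E) : ℝ := P.obj x - ∑ k, y k * P.con k x

/-- The KKT conditions for the primal point `x` and the multipliers `y`. -/
structure IsKKT (x : E) (y : κ → ℝ) : Prop where
  stationary : fderiv ℝ (P.lagrangian y) x = 0
  feasible : x ∈ P.feasible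
  compl : ∀ k, y k * P.con k x = 0
  nonneg : ∀ k ∉ P.eqs, 0 ≤ y k

/-- The linear independence constraint qualification: the gradients of the constraints that vanish
at `x` are linearly independent. At a feasible point these comprise the equality constraints. -/
def LICQ (x : E) : Prop := LinearIndependent ℝ fun k : {k // P.con k x = 0} => fderiv ℝ (P.con k) x

/-- The strong second-order sufficient condition: the Hessian of the Lagrangian is positive definite
on the common kernel of the gradients of the equality constraints and of the inequality constraints
with positive multiplier. -/
def SSOSC (x : E) (y : κ → ℝ) : Prop :=
  ∀ d ≠ 0, (∀ k, k ∈ P.eqs ∨ 0 < y k → fderiv ℝ (P.con k) x d = 0) →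
    0 < fderiv ℝ (fderiv ℝ (P.lagrangian y)) x d d

end Defs

section Basic

variable {E κ : Type*} [NormedAddCommGroup E] [NormedSpace ℝ E] [Fintype κ] {P : NLP E κ} {x : E}
  {y : κ → ℝ}

theorem fderiv_lagrangian (hobj : DifferentiableAt ℝ P.obj x)
    (hcon : ∀ k, DifferentiableAt ℝ (P.con k) x) (y : κ → ℝ) :
    fderiv ℝ (P.lagrangian y) x = fderiv ℝ P.obj x - ∑ k, y k • fderiv ℝ (P.con k) x :=
  (hobj.hasFDerivAt.fun_sub
    (HasFDerivAt.fun_sum fun k _ => (hcon k).hasFDerivAt.const_mul (y k))).fderiv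

theorem IsKKT.eq_zero_of_con_ne_zero (h : P.IsKKT x y) {k : κ} (hk : P.con k x ≠ 0) : y k = 0 :=
  (mul_eq_zero.1 (h.compl k)).resolve_right hk

theorem LICQ.eq_zero (h : P.LICQ x) {a : κ → ℝ} (ha : ∀ k, P.con k x ≠ 0 → a k = 0)
    (hsum : ∑ k, a k • fderiv ℝ (P.con k) x = 0) : a = 0 := by
  classical
  have hsub : ∑ k : {k // P.con k x = 0}, a k • fderiv ℝ (P.con k) x = 0 := by
    rw [← hsum]
    refine Fintype.sum_of_injective _ Subtype.val_injective _ _ (fun k hk => ?_) fun _ => rfl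
    rw [ha k fun h => hk ⟨⟨k, h⟩, rfl⟩, zero_smul]
  funext k
  by_cases hk : P.con k x = 0
  exacts [Fintype.linearIndependent_iff.1 h _ hsub ⟨k, hk⟩, ha k hk]

theorem IsKKT.multiplier_unique {y' : κ → ℝ} (hobj : DifferentiableAt ℝ P.obj x)
    (hcon : ∀ k, DifferentiableAt ℝ (P.con k) x) (hL : P.LICQ x) (h : P.IsKKT x y)
    (h' : fderiv ℝ (P.lagrangian y') x = 0) (hcompl : ∀ k, P.con k x ≠ 0 → y' k = 0) : y' = y := by
  rw [fderiv_lagrangian hobj hcon, sub_eq_zero] at h'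
  have hst := h.stationary
  rw [fderiv_lagrangian hobj hcon, sub_eq_zero, h'] at hst
  refine sub_eq_zero.1 (hL.eq_zero (fun k hk => ?_) ?_)
  · rw [Pi.sub_apply, hcompl k hk, h.eq_zero_of_con_ne_zero hk, sub_zero]
  · simp only [Pi.sub_apply, sub_smul, Finset.sum_sub_distrib, hst, sub_self]

end Basic

/-! ### First-order optimality conditions -/

section FirstOrder

variable {E κ : Type*} [NormedAddCommGroup E] [NormedSpace ℝ E] {P : NLP E κ} {x : E}

theorem LICQ.exists_fderiv_apply_eq [Finite κ] (h : P.LICQ x) (a : κ → ℝ) :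
    ∃ d, ∀ k, P.con k x = 0 → fderiv ℝ (P.con k) x d = a k := by
  obtain ⟨d, hd⟩ := surjective_pi_of_linearIndependent h fun k => a k
  exact ⟨d, fun k hk => congrFun hd ⟨k, hk⟩⟩

variable [CompleteSpace E]

theorem LICQ.fderiv_obj_nonneg [Finite κ] (hL : P.LICQ x) (hobj : DifferentiableAt ℝ P.obj x)
    (hcon : ∀ k, ContDiffAt ℝ 1 (P.con k) x) (hx : x ∈ P.feasible)
    (hmin : IsLocalMinOn P.obj P.feasible x) {d : E}
    (hd : ∀ k, P.con k x = 0 → 0 ≤ fderiv ℝ (P.con k) x d)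
    (hdeq : ∀ k ∈ P.eqs, fderiv ℝ (P.con k) x d = 0) : 0 ≤ fderiv ℝ P.obj x d := by
  have := Fintype.ofFinite {k // P.con k x = 0}
  obtain ⟨γ, hγ0, hγ, hcurve⟩ := exists_hasDerivAt_curve_of_surjective
    (hasStrictFDerivAt_pi.2 fun k : {k // P.con k x = 0} =>
      (hcon k).hasStrictFDerivAt one_ne_zero) (surjective_pi_of_linearIndependent hL) d
  have htend : Tendsto γ (𝓝 0) (𝓝 x) := hγ0 ▸ hγ.continuousAt.tendsto
  have hinactive : ∀ᶠ t in 𝓝 0, ∀ k, 0 < P.con k x → 0 < P.con k (γ t) :=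
    eventually_all.2 fun k => eventually_imp_distrib_left.2 fun hk =>
      ((hcon k).continuousAt.tendsto.comp htend).eventually_const_lt hk
  have hfeas : ∀ᶠ t in 𝓝[>] 0, γ t ∈ P.feasible := by
    filter_upwards [hcurve.filter_mono nhdsWithin_le_nhds, hinactive.filter_mono
      nhdsWithin_le_nhds, self_mem_nhdsWithin] with t hactive hpos ht
    have hactive' : ∀ k, P.con k x = 0 → P.con k (γ t) = t * fderiv ℝ (P.con k) x d :=
      fun k hk => by simpa [hk] using congrFun hactive ⟨k, hk⟩
    refine ⟨fun k => ?_, fun k hk => by rw [hactive' k (hx.2 k hk), hdeq k hk, mul_zero]⟩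
    rcases (hx.1 k).eq_or_lt with hk | hk
    · rw [hactive' k hk.symm]
      exact mul_nonneg (le_of_lt ht) (hd k hk.symm)
    · exact (hpos k hk).le
  have hslope : Tendsto (fun t => t⁻¹ • (P.obj (γ t) - P.obj x)) (𝓝[>] 0)
      (𝓝 (fderiv ℝ P.obj x d)) := by
    have hobjγ : HasFDerivAt P.obj (fderiv ℝ P.obj x) (γ 0) := hγ0.symm ▸ hobj.hasFDerivAt
    simpa [hγ0] using (hobjγ.comp_hasDerivAt (0 : ℝ) hγ).tendsto_slope_zero_right
  have hγfeas : Tendsto γ (𝓝[>] 0) (𝓝[P.feasible] x) :=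
    tendsto_nhdsWithin_iff.2 ⟨htend.mono_left nhdsWithin_le_nhds, hfeas⟩
  refine ge_of_tendsto hslope ?_
  filter_upwards [hγfeas.eventually hmin, self_mem_nhdsWithin] with t hle ht
  exact mul_nonneg (inv_nonneg.2 (le_of_lt ht)) (sub_nonneg.2 hle)

theorem LICQ.exists_isKKT_of_isLocalMinOn [Fintype κ] (hL : P.LICQ x)
    (hobj : DifferentiableAt ℝ P.obj x) (hcon : ∀ k, ContDiffAt ℝ 1 (P.con k) x)
    (hx : x ∈ P.feasible) (hmin : IsLocalMinOn P.obj P.feasible x) : ∃ y, P.IsKKT x y := by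
  classical
  have hdir := fun d => hL.fderiv_obj_nonneg hobj hcon hx hmin (d := d)
  have hker : ⨅ k : {k // P.con k x = 0}, LinearMap.ker (fderiv ℝ (P.con k) x : E →ₗ[ℝ] ℝ) ≤
      LinearMap.ker (fderiv ℝ P.obj x : E →ₗ[ℝ] ℝ) := by
    intro d hd
    have hd0 : ∀ k, P.con k x = 0 → fderiv ℝ (P.con k) x d = 0 := fun k hk =>
      (Submodule.mem_iInf _).1 hd ⟨k, hk⟩
    have hneg := hdir (-d) (fun k hk => by simp [hd0 k hk]) fun k hk => by
      simp [hd0 k (hx.2 k hk)]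
    rw [map_neg, neg_nonneg] at hneg
    exact hneg.antisymm (hdir d (fun k hk => (hd0 k hk).ge) fun k hk => hd0 k (hx.2 k hk))
  obtain ⟨c, hc⟩ := (Submodule.mem_span_range_iff_exists_fun ℝ).1
    (mem_span_of_iInf_ker_le_ker hker)
  let y : κ → ℝ := fun k => if hk : P.con k x = 0 then c ⟨k, hk⟩ else 0
  have hy : ∑ k, y k • fderiv ℝ (P.con k) x = fderiv ℝ P.obj x := by
    rw [← ContinuousLinearMap.coe_inj, ← hc, ContinuousLinearMap.toLinearMap_sum]
    refine (Fintype.sum_of_injective _ Subtype.val_injective _ _ (fun k hk => ?_) fun k => ?_).symm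
    · simp [y, dif_neg fun h => hk ⟨⟨k, h⟩, rfl⟩]
    · simp [y, k.2]
  refine ⟨y, ?_, hx, fun k => ?_, fun k hk => ?_⟩
  · rw [fderiv_lagrangian hobj fun k => (hcon k).differentiableAt one_ne_zero, hy, sub_self]
  · by_cases hk : P.con k x = 0 <;> simp [y, hk]
  · obtain ⟨d, hd⟩ := hL.exists_fderiv_apply_eq (Pi.single k 1)
    have hyk : fderiv ℝ P.obj x d = y k :=
      calc fderiv ℝ P.obj x d = ∑ j, y j * fderiv ℝ (P.con j) x d := by simp [← hy]
        _ = ∑ j, y j * (Pi.single k 1 : κ → ℝ) j := Finset.sum_congr rfl fun j _ => by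
          by_cases hj : P.con j x = 0
          · rw [hd j hj]
          · simp [y, hj]
        _ = y k := by simp [Pi.single_apply]
    rw [← hyk]
    refine hdir d (fun j hj => ?_) fun j hj => ?_
    · rw [hd j hj, Pi.single_apply]
      split_ifs <;> norm_num
    · rw [hd j (hx.2 j hj), Pi.single_eq_of_ne fun h : j = k => hk (h ▸ hj)]

end FirstOrder

/-! ### Second-order sufficient conditions -/

section SecondOrder

variable {E κ : Type*} [NormedAddCommGroup E] [NormedSpace ℝ E] [Fintype κ] {P : NLP E κ} {x : E}
  {y : κ → ℝ}

theorem contDiff_lagrangian {r : WithTop ℕ∞} (hobj : ContDiff ℝ r P.obj)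
    (hcon : ∀ k, ContDiff ℝ r (P.con k)) (y : κ → ℝ) : ContDiff ℝ r (P.lagrangian y) :=
  hobj.sub (ContDiff.sum fun k _ => contDiff_const.mul (hcon k))

theorem IsKKT.lagrangian_le (h : P.IsKKT x y) {x' : E} (hx' : x' ∈ P.feasible)
    (hobj : P.obj x' ≤ P.obj x) : P.lagrangian y x' ≤ P.lagrangian y x := by
  refine sub_le_sub hobj (Finset.sum_le_sum fun k _ => ?_)
  rw [h.compl k]
  by_cases hk : k ∈ P.eqs
  · rw [hx'.2 k hk, mul_zero]
  · exact mul_nonneg (h.nonneg k hk) (hx'.1 k)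

/-- By stationarity the nonnegative numbers `y k * fderiv ℝ (P.con k) x d` sum up to
`fderiv ℝ P.obj x d`, which is nonpositive, so they all vanish. -/
theorem IsKKT.fderiv_con_eq_zero_of_tendsto (h : P.IsKKT x y) (hobj : DifferentiableAt ℝ P.obj x)
    (hcon : ∀ k, DifferentiableAt ℝ (P.con k) x) {l : Filter E} [NeBot l] {d : E} (hl : l ≤ 𝓝 x)
    (hfeas : ∀ᶠ x' in l, x' ∈ P.feasible ∧ P.obj x' ≤ P.obj x)
    (hd : Tendsto (fun x' => ‖x' - x‖⁻¹ • (x' - x)) l (𝓝 d)) {k : κ}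
    (hk : k ∈ P.eqs ∨ 0 < y k) : fderiv ℝ (P.con k) x d = 0 := by
  have hlim := fun k => tendsto_inv_norm_mul_sub (hcon k).hasFDerivAt hl hd
  have hobj_le : fderiv ℝ P.obj x d ≤ 0 :=
    le_of_tendsto (tendsto_inv_norm_mul_sub hobj.hasFDerivAt hl hd) (hfeas.mono fun x' hx' =>
      mul_nonpos_of_nonneg_of_nonpos (by positivity) (sub_nonpos.2 hx'.2))
  have heq : ∀ k ∈ P.eqs, fderiv ℝ (P.con k) x d = 0 := fun k hk =>
    tendsto_nhds_unique_of_eventuallyEq (hlim k) tendsto_const_nhds (hfeas.mono fun x' hx' => by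
      simp [hx'.1.2 k hk, h.feasible.2 k hk])
  have hactive : ∀ k, P.con k x = 0 → 0 ≤ fderiv ℝ (P.con k) x d := fun k hk =>
    ge_of_tendsto (hlim k) (hfeas.mono fun x' hx' => by
      rw [hk, sub_zero]
      exact mul_nonneg (by positivity) (hx'.1.1 k))
  have hterm : ∀ k, 0 ≤ y k * fderiv ℝ (P.con k) x d := by
    intro k
    by_cases hk : k ∈ P.eqs
    · rw [heq k hk, mul_zero]
    · by_cases hk0 : P.con k x = 0
      · exact mul_nonneg (h.nonneg k hk) (hactive k hk0)
      · rw [h.eq_zero_of_con_ne_zero hk0, zero_mul]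
  have hsum : ∑ k, y k * fderiv ℝ (P.con k) x d ≤ 0 := by
    have hst := h.stationary
    rw [fderiv_lagrangian hobj hcon, sub_eq_zero] at hst
    simpa [hst] using hobj_le
  have hzero := (Finset.sum_eq_zero_iff_of_nonneg fun k _ => hterm k).1
    (hsum.antisymm (Finset.sum_nonneg fun k _ => hterm k)) k (Finset.mem_univ k)
  exact hk.elim (heq k) fun hk => (mul_eq_zero.1 hzero).resolve_left hk.ne'

theorem IsKKT.eventually_obj_lt [FiniteDimensional ℝ E] (h : P.IsKKT x y) (hS : P.SSOSC x y)
    (hobj : ContDiff ℝ 2 P.obj) (hcon : ∀ k, ContDiff ℝ 2 (P.con k)) :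
    ∀ᶠ x' in 𝓝 x, x' ∈ P.feasible → x' ≠ x → P.obj x < P.obj x' := by
  by_contra hnot
  obtain ⟨u, d, hu, hmem, hd0, hd⟩ := exists_ultrafilter_tendsto_direction
    (X := {x' | x' ∈ P.feasible ∧ P.obj x' ≤ P.obj x}) (x := x) <| by
      refine (not_eventually.1 hnot).mono fun x' hx' => ?_
      push Not at hx'
      exact ⟨⟨hx'.1, hx'.2.2⟩, hx'.2.1⟩
  have hlag := contDiff_lagrangian hobj hcon y
  refine (hS d hd0 fun k hk => ?_).not_ge <| fderiv_fderiv_apply_nonpos_of_tendsto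
    (hlag.differentiable two_ne_zero) (hasFDerivAt_fderiv hlag x).differentiableAt h.stationary hu
    (mem_of_superset hmem fun x' hx' => h.lagrangian_le hx'.1 hx'.2) hd
  exact h.fderiv_con_eq_zero_of_tendsto (hobj.differentiable two_ne_zero x)
    (fun k => (hcon k).differentiable two_ne_zero x) (hu.trans nhdsWithin_le_nhds) hmem hd hk

end SecondOrder

/-! ### Regularity of the KKT system -/

section Regularity

variable {E κ : Type*} [NormedAddCommGroup E] [NormedSpace ℝ E] [Fintype κ] {P : NLP E κ} {x : E}
  {y : κ → ℝ}

open Classical in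
/-- The square system of the KKT equations for the working set `B`: stationarity of the Lagrangian,
`con k = 0` for `k ∈ B`, and vanishing multipliers outside `B`. -/
noncomputable def kktMap (P : NLP E κ) (B : Set κ) (v : E × (κ → ℝ)) : (E →L[ℝ] ℝ) × (κ → ℝ) :=
  (fderiv ℝ (P.lagrangian v.2) v.1, B.piecewise (fun k => P.con k v.1) v.2)

theorem kktMap_eq_zero_iff {B : Set κ} {v : E × (κ → ℝ)} :
    P.kktMap B v = 0 ↔ fderiv ℝ (P.lagrangian v.2) v.1 = 0 ∧ (∀ k ∈ B, P.con k v.1 = 0) ∧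
      ∀ k ∉ B, v.2 k = 0 := by
  rw [kktMap, Prod.mk_eq_zero, funext_iff]
  refine and_congr_right fun _ => ⟨fun h => ⟨fun k hk => ?_, fun k hk => ?_⟩, fun h k => ?_⟩
  · simpa [hk] using h k
  · simpa [hk] using h k
  · by_cases hk : k ∈ B
    · simpa [hk] using h.1 k hk
    · simpa [hk] using h.2 k hk

theorem fderiv_fderiv_lagrangian_apply (hobj : ContDiff ℝ 2 P.obj)
    (hcon : ∀ k, ContDiff ℝ 2 (P.con k)) (x d : E) (y : κ → ℝ) :
    fderiv ℝ (fderiv ℝ (P.lagrangian y)) x d =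
      fderiv ℝ (fderiv ℝ P.obj) x d - ∑ k, y k • fderiv ℝ (fderiv ℝ (P.con k)) x d := by
  have hlag : fderiv ℝ (P.lagrangian y) =
      fun x => fderiv ℝ P.obj x - ∑ k, y k • fderiv ℝ (P.con k) x :=
    funext fun x => fderiv_lagrangian (hobj.differentiable two_ne_zero x)
      (fun k => (hcon k).differentiable two_ne_zero x) y
  rw [hlag, ((hasFDerivAt_fderiv hobj x).fun_sub (HasFDerivAt.fun_sum fun k _ =>
    (hasFDerivAt_fderiv (hcon k) x).fun_const_smul (y k))).fderiv]
  simp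

open Classical ContinuousLinearMap in
theorem fderiv_kktMap_apply (hobj : ContDiff ℝ 2 P.obj) (hcon : ∀ k, ContDiff ℝ 2 (P.con k))
    (B : Set κ) (x d : E) (y η : κ → ℝ) :
    fderiv ℝ (P.kktMap B) (x, y) (d, η) =
      (fderiv ℝ (fderiv ℝ (P.lagrangian y)) x d - ∑ k, η k • fderiv ℝ (P.con k) x,
        B.piecewise (fun k => fderiv ℝ (P.con k) x d) η) := by
  have hdiff : ∀ k, Differentiable ℝ (P.con k) := fun k => (hcon k).differentiable two_ne_zero
  have hkkt : P.kktMap B = fun v => (fderiv ℝ P.obj v.1 - ∑ k, v.2 k • fderiv ℝ (P.con k) v.1,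
      B.piecewise (fun k => P.con k v.1) v.2) := funext fun v => Prod.ext
    (fderiv_lagrangian (hobj.differentiable two_ne_zero _) (fun k => hdiff k _) _) rfl
  have hmult : ∀ k, HasFDerivAt (fun v : E × (κ → ℝ) => v.2 k)
      (proj k ∘L snd ℝ E (κ → ℝ)) (x, y) := fun k => (proj k ∘L snd ℝ E (κ → ℝ)).hasFDerivAt
  have hgrad : ∀ k, HasFDerivAt (fun v : E × (κ → ℝ) => fderiv ℝ (P.con k) v.1)
      (fderiv ℝ (fderiv ℝ (P.con k)) x ∘L fst ℝ E (κ → ℝ)) (x, y) := fun k =>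
    (hasFDerivAt_fderiv (hcon k) x).comp (x, y) hasFDerivAt_fst
  have hwork : ∀ k, HasFDerivAt
      (fun v : E × (κ → ℝ) => B.piecewise (fun k => P.con k v.1) v.2 k)
      (if k ∈ B then fderiv ℝ (P.con k) x ∘L fst ℝ E (κ → ℝ)
        else proj k ∘L snd ℝ E (κ → ℝ)) (x, y) := by
    intro k
    by_cases hk : k ∈ B
    · simp only [hk, piecewise_eq_of_mem, if_true]
      exact (hdiff k x).hasFDerivAt.comp (x, y) hasFDerivAt_fst
    · simpa only [hk, not_false_eq_true, piecewise_eq_of_notMem, if_false] using hmult k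
  have hderiv := (((hasFDerivAt_fderiv hobj x).comp (x, y) hasFDerivAt_fst).fun_sub
    (HasFDerivAt.fun_sum (u := Finset.univ) fun k _ => (hmult k).fun_smul (hgrad k))).prodMk
      (hasFDerivAt_pi.2 hwork)
  rw [hkkt]
  refine (congrArg (fun D => D (d, η)) hderiv.fderiv).trans (Prod.ext ?_ (funext fun k => ?_))
  · simp [fderiv_fderiv_lagrangian_apply hobj hcon, Finset.sum_add_distrib, sub_add_eq_sub_sub]
  · by_cases hk : k ∈ B <;> simp [hk]

/-- `B` is a possible active set near the KKT point `(x, y)`: it consists of constraints that vanish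
at `x`, among them all equality constraints and all constraints with a nonzero multiplier. -/
structure IsWorkingSet (P : NLP E κ) (x : E) (y : κ → ℝ) (B : Set κ) : Prop where
  eqs_subset : P.eqs ⊆ B
  mem_of_multiplier_ne_zero : ∀ k, y k ≠ 0 → k ∈ B
  con_eq_zero : ∀ k ∈ B, P.con k x = 0

theorem IsWorkingSet.kktMap_eq_zero {B : Set κ} (hB : P.IsWorkingSet x y B)
    (h : P.IsKKT x y) : P.kktMap B (x, y) = 0 :=
  kktMap_eq_zero_iff.2 ⟨h.stationary, hB.con_eq_zero, fun k hk => by_contra fun hne =>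
    hk (hB.mem_of_multiplier_ne_zero k hne)⟩

theorem IsWorkingSet.isInvertible_fderiv_kktMap [FiniteDimensional ℝ E] {B : Set κ}
    (hB : P.IsWorkingSet x y B) (hL : P.LICQ x) (hS : P.SSOSC x y) (hobj : ContDiff ℝ 2 P.obj)
    (hcon : ∀ k, ContDiff ℝ 2 (P.con k)) : (fderiv ℝ (P.kktMap B) (x, y)).IsInvertible := by
  classical
  have hinj : Function.Injective (fderiv ℝ (P.kktMap B) (x, y)) := by
    refine (injective_iff_map_eq_zero _).2 ?_
    rintro ⟨d, η⟩ hker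
    rw [fderiv_kktMap_apply hobj hcon, Prod.mk_eq_zero, sub_eq_zero, funext_iff] at hker
    obtain ⟨hstat, hwork⟩ := hker
    have hd : ∀ k ∈ B, fderiv ℝ (P.con k) x d = 0 := fun k hk => by simpa [hk] using hwork k
    have hη : ∀ k ∉ B, η k = 0 := fun k hk => by simpa [hk] using hwork k
    have hhess : fderiv ℝ (fderiv ℝ (P.lagrangian y)) x d d = 0 := by
      rw [hstat, sum_apply]
      refine Finset.sum_eq_zero fun k _ => ?_
      by_cases hk : k ∈ B
      · simp [hd k hk]
      · simp [hη k hk]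
    have hd0 : d = 0 := by_contra fun hne => hhess.not_gt <| hS d hne fun k hk =>
      hd k (hk.elim (@hB.eqs_subset k) fun hpos => hB.mem_of_multiplier_ne_zero k hpos.ne')
    have hη0 : η = 0 := hL.eq_zero (fun k hk => hη k fun hkB => hk (hB.con_eq_zero k hkB)) <| by
      rw [← hstat, hd0, map_zero]
    rw [hd0, hη0, Prod.mk_zero_zero]
  let e := (LinearMap.linearEquivOfInjective
    (fderiv ℝ (P.kktMap B) (x, y) : E × (κ → ℝ) →ₗ[ℝ] (E →L[ℝ] ℝ) × (κ → ℝ)) hinj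
    (by simp [← LinearMap.toContinuousLinearMap.finrank_eq])).toContinuousLinearEquiv
  exact ⟨e, ContinuousLinearMap.ext fun _ => rfl⟩

end Regularity

end NLP

/-! ### Parametric nonlinear programs -/

theorem pc1At_of_eventually_exists_eq {ι E F : Type*} [Finite ι] [NormedAddCommGroup E]
    [NormedSpace ℝ E] [NormedAddCommGroup F] [NormedSpace ℝ F] {z : E → F} {p : E} {φ : ι → E → F}
    (hφ : ∀ i, ContDiffAt ℝ 1 (φ i) p)
    (hz : ∀ᶠ q in 𝓝 p, ContinuousAt z q ∧ ∃ i, z q = φ i q) : PC1At z p := by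
  obtain ⟨N, ⟨e⟩⟩ := Finite.exists_equiv_fin ι
  have hφ' : ∀ᶠ q in 𝓝 p, ∀ i, ContDiffAt ℝ 1 (φ i) q :=
    eventually_all.2 fun i => (hφ i).eventually (by simp)
  obtain ⟨V, hV, hVo, hpV⟩ := eventually_nhds_iff.1 (hz.and hφ')
  refine ⟨V, hVo, hpV, fun q hq => (hV q hq).1.1.continuousWithinAt, N, fun k => φ (e.symm k),
    fun k q hq => ((hV q hq).2 _).contDiffWithinAt, fun q hq => ?_⟩
  obtain ⟨i, hi⟩ := (hV q hq).1.2
  exact ⟨e i, by simpa using hi⟩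

theorem PC1At.contDiff_comp {E F G : Type*} [NormedAddCommGroup E] [NormedSpace ℝ E]
    [NormedAddCommGroup F] [NormedSpace ℝ F] [NormedAddCommGroup G] [NormedSpace ℝ G] {g : F → G}
    (hg : ContDiff ℝ 1 g) {z : E → F} {p : E} (hz : PC1At z p) : PC1At (fun q => g (z q)) p := by
  obtain ⟨V, hVo, hpV, hcont, N, φ, hφ, hsel⟩ := hz
  refine ⟨V, hVo, hpV, hg.continuous.comp_continuousOn hcont, N, fun k q => g (φ k q),
    fun k => hg.comp_contDiffOn (hφ k), fun q hq => ?_⟩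
  obtain ⟨k, hk⟩ := hsel q hq
  exact ⟨k, congrArg g hk⟩

/-- On a compact neighborhood `K` of the strict local minimizer, the objective on the frontier of
`K` exceeds its values near the minimizer. This persists for nearby parameters and forces a
minimizer over `K` into the interior of `K`. -/
theorem eventually_exists_isLocalMinOn {X Y : Type*} [TopologicalSpace X] [LocallyCompactSpace X]
    [T2Space X] [TopologicalSpace Y] {f : X × Y → ℝ} (hf : Continuous f) {C : Set (X × Y)}
    (hC : IsClosed C) {x : X} {p : Y}
    (hmin : ∀ᶠ x' in 𝓝 x, (x', p) ∈ C → x' ≠ x → f (x, p) < f (x', p))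
    (hlsc : ∀ N ∈ 𝓝 (x, p), ∀ᶠ q in 𝓝 p, ∃ y, (y, q) ∈ N ∩ C) {V : Set X} (hV : V ∈ 𝓝 x) :
    ∀ᶠ q in 𝓝 p, ∃ y ∈ V, (y, q) ∈ C ∧
      IsLocalMinOn (fun x => f (x, q)) {x | (x, q) ∈ C} y := by
  obtain ⟨K, hK, hKV, hKc⟩ := local_compact_nhds (inter_mem hV hmin)
  have hfrontier : ∀ᶠ u in 𝓝 (x, p), ∀ x' ∈ frontier K, (x', u.2) ∈ C → f u < f (x', u.2) := by
    refine (hKc.of_isClosed_subset isClosed_frontier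
      hKc.isClosed.frontier_subset).eventually_forall_of_forall_eventually fun x' hx' => ?_
    have htend : Tendsto (fun u : (X × Y) × X => (u.2, u.1.2)) (𝓝 ((x, p), x')) (𝓝 (x', p)) :=
      (by fun_prop : Continuous fun u : (X × Y) × X => (u.2, u.1.2)).tendsto _
    by_cases hx'C : (x', p) ∈ C
    · have hne : x' ≠ x := by
        rintro rfl
        exact hx'.2 (mem_interior_iff_mem_nhds.2 hK)
      have hlt := (hKV (hKc.isClosed.frontier_subset hx')).2 hx'C hne
      filter_upwards [((hf.comp continuous_fst).tendsto ((x, p), x')).eventually_lt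
        ((hf.tendsto (x', p)).comp htend) hlt] with u hu _ using hu
    · filter_upwards [htend (hC.isOpen_compl.mem_nhds hx'C)] with u hu huC using absurd huC hu
  filter_upwards [hlsc _ (inter_mem hfrontier (continuousAt_fst.preimage_mem_nhds hK))]
    with q ⟨y₀, ⟨hy₀lt, hy₀K⟩, hy₀C⟩
  have hslice : IsClosed {x | (x, q) ∈ C} := hC.preimage (by fun_prop)
  obtain ⟨y, ⟨hyK, hyC⟩, hymin⟩ := (hKc.inter_right hslice).exists_isMinOn ⟨y₀, hy₀K, hy₀C⟩
    (f := fun x => f (x, q)) (by fun_prop)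
  have hyint : K ∈ 𝓝 y := by
    by_contra hnot
    exact (hy₀lt y ⟨subset_closure hyK, fun h => hnot (mem_interior_iff_mem_nhds.1 h)⟩ hyC).not_ge
      (hymin ⟨hy₀K, hy₀C⟩)
  refine ⟨y, (hKV hyK).1, hyC, ?_⟩
  filter_upwards [nhdsWithin_le_nhds hyint, self_mem_nhdsWithin] with x' hx'K hx'C
  exact hymin ⟨hx'K, hx'C⟩

theorem eventually_forall_ne_zero_imp_ne_zero {κ X Z : Type*} [Finite κ] [TopologicalSpace Z]
    {c : κ → Z → ℝ} {z : Z} (hc : ∀ k, ContinuousAt (c k) z) {l : Filter X} {u : X → Z}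
    (hu : Tendsto u l (𝓝 z)) : ∀ᶠ t in l, ∀ k, c k z ≠ 0 → c k (u t) ≠ 0 :=
  eventually_all.2 fun k => eventually_imp_distrib_left.2 fun hk =>
    ((hc k).tendsto.comp hu).eventually_ne hk

namespace NLP

/-- The member of a parametric family of nonlinear programs that belongs to the parameter `p`. -/
def atParam {E κ Θ : Type*} (f : E × Θ → ℝ) (c : κ → E × Θ → ℝ) (A : Set κ) (p : Θ) : NLP E κ where
  obj x := f (x, p)
  con k x := c k (x, p)
  eqs := A

theorem isClosed_feasible_atParam {E κ Θ : Type*} [TopologicalSpace E] [TopologicalSpace Θ]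
    {f : E × Θ → ℝ} {c : κ → E × Θ → ℝ} {A : Set κ} (hc : ∀ k, Continuous (c k)) :
    IsClosed {u : E × Θ | u.1 ∈ (atParam f c A u.2).feasible} := by
  have h : {u : E × Θ | u.1 ∈ (atParam f c A u.2).feasible} =
      (⋂ k, {u | 0 ≤ c k u}) ∩ ⋂ k ∈ A, {u | c k u = 0} := by
    ext u
    simp [feasible, atParam]
  rw [h]
  exact (isClosed_iInter fun k => isClosed_le continuous_const (hc k)).inter
    (isClosed_biInter fun k _ => isClosed_eq (hc k) continuous_const)

variable {E κ Θ : Type*} [NormedAddCommGroup E] [NormedSpace ℝ E]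
  [NormedAddCommGroup Θ] [NormedSpace ℝ Θ] {f : E × Θ → ℝ} {c : κ → E × Θ → ℝ} {A : Set κ}
  {x : E} {p : Θ}

theorem fderiv_prodMk_left_apply {φ : E × Θ → ℝ} (hφ : DifferentiableAt ℝ φ (x, p)) (d : E) :
    fderiv ℝ (fun x => φ (x, p)) x d = fderiv ℝ φ (x, p) (d, 0) := by
  have h : HasFDerivAt (fun x => φ (x, p)) _ x :=
    hφ.hasFDerivAt.comp x (hasFDerivAt_prodMk_left x p)
  rw [h.fderiv]
  simp

theorem LICQ.eventually_atParam [Finite κ] (hc : ∀ k, ContDiff ℝ 2 (c k))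
    (hL : (atParam f c A p).LICQ x) :
    ∀ᶠ u in 𝓝 (x, p), (atParam f c A u.2).LICQ u.1 := by
  have hgrad : ∀ k, Continuous fun u : E × Θ => fderiv ℝ (fun x => c k (x, u.2)) u.1 := fun k =>
    (ContDiff.fderiv (n := 1) (m := 2) (f := fun (u : E × Θ) x => c k (x, u.2))
      ((hc k).comp (f := fun v : (E × Θ) × E => (v.2, v.1.2)) (by fun_prop)) contDiff_fst
      le_rfl).continuous
  have hindep : ∀ᶠ u in 𝓝 (x, p), LinearIndependent ℝ
      fun k : {k // c k (x, p) = 0} => fderiv ℝ (fun x => c k (x, u.2)) u.1 :=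
    (tendsto_pi_nhds.2 fun k : {k // c k (x, p) = 0} => (hgrad k).tendsto (x, p)).eventually
      (LinearIndependent.eventually (f := fun k : {k // c k (x, p) = 0} =>
        fderiv ℝ (fun x => c k (x, p)) x) hL)
  filter_upwards [hindep, eventually_forall_ne_zero_imp_ne_zero
    (fun k => (hc k).continuous.continuousAt) tendsto_id] with u hu hne
  have hactive : ∀ k, c k u = 0 → c k (x, p) = 0 := fun k hk => by_contra fun h => hne k h hk
  exact hu.comp (Subtype.map id hactive) (Subtype.map_injective hactive Function.injective_id)

theorem LICQ.eventually_exists_feasible [Finite κ] [CompleteSpace E] [CompleteSpace Θ]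
    (hc : ∀ k, ContDiffAt ℝ 1 (c k) (x, p)) (hL : (atParam f c A p).LICQ x)
    (hx : x ∈ (atParam f c A p).feasible) {N : Set (E × Θ)} (hN : N ∈ 𝓝 (x, p)) :
    ∀ᶠ q in 𝓝 p, ∃ x', (x', q) ∈ N ∧ x' ∈ (atParam f c A q).feasible := by
  have := Fintype.ofFinite {k // c k (x, p) = 0}
  let D : E × Θ →L[ℝ] ({k // c k (x, p) = 0} → ℝ) × Θ :=
    (ContinuousLinearMap.pi fun k : {k // c k (x, p) = 0} => fderiv ℝ (c k) (x, p)).prod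
      (.snd ℝ E Θ)
  have hD : HasStrictFDerivAt
      (fun u : E × Θ => ((fun k : {k // c k (x, p) = 0} => c k u), u.2)) D (x, p) :=
    (hasStrictFDerivAt_pi.2 fun k : {k // c k (x, p) = 0} =>
      (hc k).hasStrictFDerivAt one_ne_zero).prodMk hasStrictFDerivAt_snd
  have hsurj : D.range = ⊤ := by
    refine LinearMap.range_eq_top.2 fun ⟨a, q⟩ => ?_
    obtain ⟨d, hd⟩ := surjective_pi_of_linearIndependent hL
      (a - fun k : {k // c k (x, p) = 0} => fderiv ℝ (c k) (x, p) (0, q))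
    refine ⟨(d, q), Prod.ext (funext fun k => ?_) rfl⟩
    have hk : fderiv ℝ (c k) (x, p) (d, 0) = a k - fderiv ℝ (c k) (x, p) (0, q) :=
      (fderiv_prodMk_left_apply ((hc k).differentiableAt one_ne_zero) d).symm.trans (congrFun hd k)
    calc fderiv ℝ (c k) (x, p) (d, q)
        = fderiv ℝ (c k) (x, p) (d, 0) + fderiv ℝ (c k) (x, p) (0, q) := by simp [← map_add]
      _ = a k := by rw [hk, sub_add_cancel]
  have hinactive : ∀ᶠ u in 𝓝 (x, p), ∀ k, 0 < c k (x, p) → 0 < c k u :=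
    eventually_all.2 fun k => eventually_imp_distrib_left.2 fun hk =>
      (hc k).continuousAt.eventually_const_lt hk
  have himage := image_mem_map (f := 𝓝 (x, p)) (inter_mem hN hinactive)
    (m := fun u : E × Θ => ((fun k : {k // c k (x, p) = 0} => c k u), u.2))
  rw [hD.map_nhds_eq_of_surj hsurj, funext fun k : {k // c k (x, p) = 0} => k.2] at himage
  filter_upwards [(by fun_prop : Continuous fun q : Θ =>
    ((fun _ : {k // c k (x, p) = 0} => (0 : ℝ)), q)).tendsto p himage] with q hq
  obtain ⟨⟨x', q'⟩, ⟨hxN, hpos⟩, hx'⟩ := hq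
  obtain ⟨hactive, rfl⟩ := Prod.ext_iff.1 hx'
  have hzero : ∀ k, c k (x, p) = 0 → c k (x', q') = 0 := fun k hk => congrFun hactive ⟨k, hk⟩
  exact ⟨x', hxN, fun k => (hx.1 k).eq_or_lt.elim (fun hk => (hzero k hk.symm).ge)
    fun hk => (hpos k hk).le, fun k hk => hzero k (hx.2 k hk)⟩

variable [Fintype κ]

theorem contDiff_kktMap_atParam (hf : ContDiff ℝ 2 f) (hc : ∀ k, ContDiff ℝ 2 (c k)) (B : Set κ) :
    ContDiff ℝ 1 fun u : Θ × E × (κ → ℝ) => (atParam f c A u.1).kktMap B u.2 := by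
  classical
  refine ContDiff.prodMk ?_ (contDiff_pi.2 fun k => ?_)
  · refine ContDiff.fderiv (n := 1) (m := 2)
      (f := fun (u : Θ × E × (κ → ℝ)) => (atParam f c A u.1).lagrangian u.2.2) ?_ (by fun_prop)
      le_rfl
    have hpair : ContDiff ℝ 2 fun v : (Θ × E × (κ → ℝ)) × E => (v.2, v.1.1) := by fun_prop
    exact (hf.comp hpair).sub (ContDiff.sum fun k _ =>
      ContDiff.mul (by fun_prop) ((hc k).comp hpair))
  · by_cases hk : k ∈ B
    · simp only [hk, piecewise_eq_of_mem]
      exact ((hc k).of_le one_le_two).comp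
        (f := fun u : Θ × E × (κ → ℝ) => (u.2.1, u.1)) (by fun_prop)
    · simp only [hk, not_false_eq_true, piecewise_eq_of_notMem]
      fun_prop

variable [FiniteDimensional ℝ E] [CompleteSpace Θ]

theorem IsWorkingSet.exists_contDiffAt (hf : ContDiff ℝ 2 f) (hc : ∀ k, ContDiff ℝ 2 (c k))
    {y : κ → ℝ} {B : Set κ} (hB : (atParam f c A p).IsWorkingSet x y B)
    (h : (atParam f c A p).IsKKT x y) (hL : (atParam f c A p).LICQ x)
    (hS : (atParam f c A p).SSOSC x y) :
    ∃ φ : Θ → E × (κ → ℝ), ContDiffAt ℝ 1 φ p ∧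
      ∀ᶠ u in 𝓝 (p, x, y), (atParam f c A u.1).kktMap B u.2 = 0 → u.2 = φ u.1 := by
  have hF := contDiff_kktMap_atParam (A := A) hf hc B
  set F : Θ × E × (κ → ℝ) → (E →L[ℝ] ℝ) × (κ → ℝ) := fun u => (atParam f c A u.1).kktMap B u.2
  have hinv : (fderiv ℝ F (p, x, y) ∘L .inr ℝ Θ (E × (κ → ℝ))).IsInvertible := by
    have hpartial := ((hF.differentiable one_ne_zero (p, x, y)).hasFDerivAt.comp (x, y)
      (hasFDerivAt_prodMk_right p (x, y))).fderiv
    rw [← hpartial]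
    exact hB.isInvertible_fderiv_kktMap hL hS (hf.comp (contDiff_prodMk_left p))
      fun k => (hc k).comp (contDiff_prodMk_left p)
  refine ⟨_, ContDiffAt.contDiffAt_implicitFunction hF.contDiffAt one_ne_zero hinv, ?_⟩
  filter_upwards [hF.contDiffAt.eventually_apply_eq_iff_implicitFunction one_ne_zero hinv]
    with u hu hu0
  exact (hu.1 (hu0.trans (hB.kktMap_eq_zero h).symm)).symm

theorem pc1At_of_isKKT_of_continuousAt (hf : ContDiff ℝ 2 f) (hc : ∀ k, ContDiff ℝ 2 (c k))
    {z : Θ → E × (κ → ℝ)}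
    (hz : ∀ᶠ q in 𝓝 p, ContinuousAt z q ∧ (atParam f c A q).IsKKT (z q).1 (z q).2)
    (hL : (atParam f c A p).LICQ (z p).1) (hS : (atParam f c A p).SSOSC (z p).1 (z p).2) :
    PC1At z p := by
  obtain ⟨hcont, hp⟩ := hz.self_of_nhds
  choose φ hφ hzφ using fun B : {B // (atParam f c A p).IsWorkingSet (z p).1 (z p).2 B} =>
    B.2.exists_contDiffAt hf hc hp hL hS
  have hmult : ∀ᶠ q in 𝓝 p, ∀ k, (z p).2 k ≠ 0 → (z q).2 k ≠ 0 :=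
    eventually_forall_ne_zero_imp_ne_zero (c := fun k y => y k)
      (fun k => (continuous_apply k).continuousAt) hcont.snd
  refine pc1At_of_eventually_exists_eq hφ ?_
  have hcon : ∀ᶠ q in 𝓝 p, ∀ k, c k ((z p).1, p) ≠ 0 → c k ((z q).1, q) ≠ 0 :=
    eventually_forall_ne_zero_imp_ne_zero (fun k => (hc k).continuous.continuousAt)
      (hcont.fst.prodMk continuousAt_id)
  filter_upwards [hz, hmult, hcon, (continuousAt_id.prodMk hcont).eventually
    (eventually_all.2 hzφ)] with q ⟨hzc, hq⟩ hne hcne hsel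
  have hB : (atParam f c A p).IsWorkingSet (z p).1 (z p).2 {k | c k ((z q).1, q) = 0} :=
    ⟨hq.feasible.2, fun k hk => by_contra fun hk0 => hne k hk (hq.eq_zero_of_con_ne_zero hk0),
      fun k hk => by_contra fun hk0 => hcne k hk0 hk⟩
  exact ⟨hzc, ⟨_, hB⟩, hsel ⟨_, hB⟩ <| kktMap_eq_zero_iff.2
    ⟨hq.stationary, fun k hk => hk, fun k hk => hq.eq_zero_of_con_ne_zero hk⟩⟩

end NLP

/-! ### Branch problems as nonlinear programs -/

/-- The index type of the joint family of constraints `(h, -g, G, H)`. -/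
abbrev ConIdx (mh mg m : ℕ) := Fin mh ⊕ Fin mg ⊕ Fin m ⊕ Fin m

namespace PrimalDual

variable {n mh mg m : ℕ}

/-- The multipliers `(-λ, μ, ξ, ν)` of the joint family of constraints `(h, -g, G, H)`, with signs
such that the Lagrangian is `f - ∑ k, mult k * con k`. -/
def mult (z : PrimalDual n mh mg m) : ConIdx mh mg m → ℝ :=
  Sum.elim (fun i => -z.lam i) (Sum.elim z.mu (Sum.elim z.xi z.nu))

/-- The primal-dual vector with primal component `w` and joint multipliers `y`. -/
noncomputable def ofMult (w : Vec n) (y : ConIdx mh mg m → ℝ) : PrimalDual n mh mg m :=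
  (w, WithLp.toLp 2 fun i => -y (.inl i), WithLp.toLp 2 fun i => y (.inr (.inl i)),
    WithLp.toLp 2 fun i => y (.inr (.inr (.inl i))),
    WithLp.toLp 2 fun i => y (.inr (.inr (.inr i))))

@[simp] theorem w_ofMult (w : Vec n) (y : ConIdx mh mg m → ℝ) : (ofMult w y).w = w := rfl

@[simp] theorem mult_ofMult (w : Vec n) (y : ConIdx mh mg m → ℝ) : (ofMult w y).mult = y := by
  funext k
  rcases k with i | i | i | i <;> simp [mult, ofMult, lam, mu, xi, nu]

@[simp] theorem ofMult_mult (z : PrimalDual n mh mg m) : ofMult z.w z.mult = z := by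
  simp [mult, ofMult, lam, mu, xi, nu, w]

theorem contDiff_ofMult : ContDiff ℝ 1 fun x : Vec n × (ConIdx mh mg m → ℝ) => ofMult x.1 x.2 := by
  unfold ofMult
  refine contDiff_fst.prodMk (ContDiff.prodMk ?_ (ContDiff.prodMk ?_ (ContDiff.prodMk ?_ ?_))) <;>
  · rw [contDiff_euclidean]
    intro i
    simp only
    fun_prop

theorem continuous_w : Continuous (w (n := n) (mh := mh) (mg := mg) (m := m)) := continuous_fst

theorem continuous_mult : Continuous (mult (n := n) (mh := mh) (mg := mg) (m := m)) := by
  refine continuous_pi fun k => ?_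
  rcases k with i | i | i | i <;> simp only [mult, lam, mu, xi, nu, Sum.elim_inl, Sum.elim_inr] <;>
    fun_prop

open Classical in
/-- The multiplier of the equality constraint that the branch problem `I` imposes on the pair `i`:
`ξ i` for the constraint `G i = 0` if `i ∈ I`, and `ν i` for the constraint `H i = 0` otherwise. -/
noncomputable def eqMultiplier (z : PrimalDual n mh mg m) (I : Set (Fin m)) (i : Fin m) : ℝ :=
  if i ∈ I then z.xi i else z.nu i

theorem eqMultiplier_of_mem (z : PrimalDual n mh mg m) {I : Set (Fin m)} {i : Fin m} (h : i ∈ I) :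
    z.eqMultiplier I i = z.xi i := if_pos h

theorem eqMultiplier_of_notMem (z : PrimalDual n mh mg m) {I : Set (Fin m)} {i : Fin m}
    (h : i ∉ I) : z.eqMultiplier I i = z.nu i := if_neg h

theorem continuous_eqMultiplier (I : Set (Fin m)) (i : Fin m) :
    Continuous fun z : PrimalDual n mh mg m => z.eqMultiplier I i := by
  by_cases h : i ∈ I <;> simp only [eqMultiplier, h, if_true, if_false, xi, nu] <;> fun_prop

end PrimalDual

namespace ParamMPCC

variable {n np mh mg m : ℕ} (Q : ParamMPCC n np mh mg m)

/-- The joint family of constraints `(h, -g, G, H)`. -/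
def con : ConIdx mh mg m → Vec n × Vec np → ℝ :=
  Sum.elim Q.h (Sum.elim (fun i u => -Q.g i u) (Sum.elim Q.G Q.H))

/-- The constraints of the joint family that are equality constraints of the branch problem `I`:
all `h i`, the `G i` with `i ∈ I` and the `H i` with `i ∉ I`. -/
def branchEqs (I : Set (Fin m)) : Set (ConIdx mh mg m) :=
  {k | Sum.elim (fun _ => True) (Sum.elim (fun _ => False) (Sum.elim (· ∈ I) (· ∉ I))) k}

/-- The branch problem `BNLP_I(p)` as a nonlinear program. -/
def branch (I : Set (Fin m)) (p : Vec np) : NLP (Vec n) (ConIdx mh mg m) :=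
  NLP.atParam Q.f Q.con (branchEqs I) p

theorem contDiff_con (k : ConIdx mh mg m) : ContDiff ℝ 2 (Q.con k) := by
  rcases k with i | i | i | i
  exacts [Q.contDiff_h i, (Q.contDiff_g i).neg, Q.contDiff_G i, Q.contDiff_H i]

variable (I : Set (Fin m)) (p : Vec np)

theorem contDiff_branch_obj : ContDiff ℝ 2 (Q.branch I p).obj :=
  Q.contDiff_f.comp (contDiff_prodMk_left p)

theorem contDiff_branch_con (k : ConIdx mh mg m) : ContDiff ℝ 2 ((Q.branch I p).con k) :=
  (Q.contDiff_con k).comp (contDiff_prodMk_left p)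

theorem differentiable_branch_obj : Differentiable ℝ (Q.branch I p).obj :=
  (Q.contDiff_branch_obj I p).differentiable two_ne_zero

theorem differentiable_branch_con (k : ConIdx mh mg m) :
    Differentiable ℝ ((Q.branch I p).con k) :=
  (Q.contDiff_branch_con I p k).differentiable two_ne_zero

theorem lagrangian_branch (z : PrimalDual n mh mg m) :
    (Q.branch I p).lagrangian z.mult = Q.lagrangian z p := by
  funext w
  simp only [NLP.lagrangian, branch, NLP.atParam, con, PrimalDual.mult, Fintype.sum_sum_type,
    Sum.elim_inl, Sum.elim_inr, lagrangian, neg_mul, mul_neg, Finset.sum_neg_distrib]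
  ring

variable {Q I p} {w : Vec n} {z : PrimalDual n mh mg m}

theorem mem_feasible_branch_iff : w ∈ (Q.branch I p).feasible ↔
    (∀ i, Q.h i (w, p) = 0) ∧ (∀ i, Q.g i (w, p) ≤ 0) ∧
      (∀ i ∈ I, Q.G i (w, p) = 0 ∧ 0 ≤ Q.H i (w, p)) ∧
        ∀ i ∉ I, Q.H i (w, p) = 0 ∧ 0 ≤ Q.G i (w, p) := by
  simp only [NLP.feasible, branch, NLP.atParam, con, branchEqs, Sum.forall, mem_ofPred_eq,
    Sum.elim_inl, Sum.elim_inr, neg_nonneg]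
  grind

theorem branchKKT_iff : Q.BranchKKT I z p ↔ (Q.branch I p).IsKKT z.w z.mult := by
  refine ⟨fun ⟨hL, hh, hg, hI, hI'⟩ => ⟨by rwa [lagrangian_branch], mem_feasible_branch_iff.2 ⟨hh,
    fun i => (hg i).2.1, fun i hi => ⟨(hI i hi).1, (hI i hi).2.1⟩,
    fun i hi => ⟨(hI' i hi).1, (hI' i hi).2.1⟩⟩, ?_, ?_⟩, fun h => ?_⟩
  · simp only [branch, NLP.atParam, con, PrimalDual.mult, Sum.forall, Sum.elim_inl, Sum.elim_inr,
      mul_neg, neg_eq_zero]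
    refine ⟨fun i => by rw [hh i, mul_zero], fun i => (hg i).2.2, fun i => ?_, fun i => ?_⟩ <;>
    by_cases hi : i ∈ I
    · rw [(hI i hi).1, mul_zero]
    · exact (hI' i hi).2.2.2
    · exact (hI i hi).2.2.2
    · rw [(hI' i hi).1, mul_zero]
  · simp only [branch, NLP.atParam, PrimalDual.mult, branchEqs, mem_ofPred_eq, Sum.forall,
      Sum.elim_inl, Sum.elim_inr]
    grind
  · obtain ⟨hL, hfeas, hcompl, hsign⟩ := h
    obtain ⟨hh, hg, hI, hI'⟩ := mem_feasible_branch_iff.1 hfeas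
    simp only [branch, NLP.atParam, con, PrimalDual.mult, branchEqs, mem_ofPred_eq, Sum.forall,
      Sum.elim_inl, Sum.elim_inr] at hcompl hsign
    rw [lagrangian_branch] at hL
    exact ⟨hL, hh, by grind, by grind, by grind⟩

theorem feasible_of_mem_feasible_branch (h : w ∈ (Q.branch I p).feasible) : Q.Feasible w p := by
  obtain ⟨hh, hg, hI, hI'⟩ := mem_feasible_branch_iff.1 h
  refine ⟨hh, hg, fun i => ?_⟩
  by_cases hi : i ∈ I
  · simp [hI i hi]
  · simp [hI' i hi]

theorem Feasible.mem_branches_iff (h : Q.Feasible w p) :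
    I ∈ Q.branches w p ↔ w ∈ (Q.branch I p).feasible := by
  rw [mem_feasible_branch_iff]
  refine ⟨?_, fun ⟨_, _, hI, hI'⟩ => ⟨I ∩ Q.I00 w p, inter_subset_right, ?_⟩⟩
  · rintro ⟨J, hJ, rfl⟩
    refine ⟨h.1, h.2.1, fun i hi => ⟨hi.elim (fun hi => hi.1) fun hi => (hJ hi).1, (h.2.2 i).2.1⟩,
      fun i hi => ⟨by_contra fun hH => hi (.inl ⟨?_, (h.2.2 i).2.1.lt_of_ne' hH⟩), (h.2.2 i).1⟩⟩
    exact (mul_eq_zero.1 (h.2.2 i).2.2).resolve_right hH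
  · ext i
    have hi := hI i
    have hi' := hI' i
    simp only [I0p, I00, mem_union, mem_inter_iff, mem_ofPred_eq]
    grind

theorem I0p_mem_branches (w : Vec n) (p : Vec np) : Q.I0p w p ∈ Q.branches w p :=
  ⟨∅, empty_subset _, (union_empty _).symm⟩

theorem mem_of_mem_I0p {i : Fin m} (hI : I ∈ Q.branches w p) (hi : i ∈ Q.I0p w p) : i ∈ I := by
  obtain ⟨J, -, rfl⟩ := hI
  exact .inl hi

theorem notMem_of_mem_Ip0 {i : Fin m} (hI : I ∈ Q.branches w p) (hi : i ∈ Q.Ip0 w p) : i ∉ I := by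
  obtain ⟨J, hJ, rfl⟩ := hI
  exact fun h => hi.1.ne' (h.elim (fun h => h.1) fun h => (hJ h).1)

theorem feasible_iff_exists_branch :
    Q.Feasible w p ↔ ∃ I : Set (Fin m), w ∈ (Q.branch I p).feasible :=
  ⟨fun h => ⟨_, h.mem_branches_iff.1 (I0p_mem_branches w p)⟩,
    fun ⟨_, h⟩ => feasible_of_mem_feasible_branch h⟩

theorem isClosed_setOf_mem_feasible_branch (Q : ParamMPCC n np mh mg m) (I : Set (Fin m)) :
    IsClosed {u : Vec n × Vec np | u.1 ∈ (Q.branch I u.2).feasible} :=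
  NLP.isClosed_feasible_atParam fun k => (Q.contDiff_con k).continuous

theorem isClosed_setOf_feasible (Q : ParamMPCC n np mh mg m) :
    IsClosed {u : Vec n × Vec np | Q.Feasible u.1 u.2} := by
  simpa only [feasible_iff_exists_branch, ofPred_exists] using
    isClosed_iUnion_of_finite Q.isClosed_setOf_mem_feasible_branch

theorem bStationary_iff : Q.BStationary w p ↔ Q.Feasible w p ∧
    ∀ I : Set (Fin m), w ∈ (Q.branch I p).feasible → ∃ y, (Q.branch I p).IsKKT w y := by
  refine and_congr_right fun h => forall_congr' fun I => ?_
  rw [h.mem_branches_iff]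
  refine imp_congr_right fun _ => ⟨?_, fun ⟨y, hy⟩ => ⟨.ofMult w y, rfl, branchKKT_iff.2 ?_⟩⟩
  · rintro ⟨z, rfl, hz⟩
    exact ⟨z.mult, branchKKT_iff.1 hz⟩
  · simpa using hy

/-! ### Constraint qualifications and second-order conditions of the branches -/

theorem GradientsIndependent.licq_branch {A : Set (Fin mg)} {K L : Set (Fin m)}
    (h : Q.GradientsIndependent w p A K L) (hA : ∀ i, Q.g i (w, p) = 0 → i ∈ A)
    (hK : ∀ i, Q.G i (w, p) = 0 → i ∈ K) (hL : ∀ i, Q.H i (w, p) = 0 → i ∈ L) (I : Set (Fin m)) :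
    (Q.branch I p).LICQ w := by
  let e : {k // (Q.branch I p).con k w = 0} → Fin mh ⊕ A ⊕ K ⊕ L := fun k =>
    match k with
    | ⟨.inl i, _⟩ => .inl i
    | ⟨.inr (.inl i), hk⟩ => .inr (.inl ⟨i, hA i (neg_eq_zero.1 hk)⟩)
    | ⟨.inr (.inr (.inl i)), hk⟩ => .inr (.inr (.inl ⟨i, hK i hk⟩))
    | ⟨.inr (.inr (.inr i)), hk⟩ => .inr (.inr (.inr ⟨i, hL i hk⟩))
  have he : Function.Injective e := by
    rintro ⟨a | a | a | a, ha⟩ ⟨b | b | b | b, hb⟩ hab <;> simp_all [e]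
  have hsigned := (LinearIndependent.comp h e he).units_smul fun k =>
    Sum.elim (fun _ => 1) (Sum.elim (fun _ => -1) fun _ => 1) k.1
  rw [NLP.LICQ]
  convert hsigned using 1
  funext ⟨k, hk⟩
  rw [Pi.smul_apply', Function.comp_apply]
  rcases k with i | i | i | i <;> simp [e, branch, NLP.atParam, con, dw]

theorem MPCCLICQ.licq_branch (h : Q.MPCCLICQ w p) (hw : Q.Feasible w p) (I : Set (Fin m)) :
    (Q.branch I p).LICQ w := by
  refine GradientsIndependent.licq_branch h (fun i hi => hi) (fun i hi => ?_) (fun i hi => ?_) I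
  · exact (hw.2.2 i).2.1.eq_or_lt.elim (fun h => .inr ⟨hi, h.symm⟩) fun h => .inl ⟨hi, h⟩
  · exact (hw.2.2 i).1.eq_or_lt.elim (fun h => .inr ⟨h.symm, hi⟩) fun h => .inl ⟨h, hi⟩

theorem BranchLICQ.licq_branch (h : Q.BranchLICQ I w p) : (Q.branch I p).LICQ w := by
  refine GradientsIndependent.licq_branch h (fun i hi => hi) (fun i hi => ?_) (fun i hi => ?_) I <;>
  by_cases h : i ∈ I <;> simp [h, hi]

theorem BranchSSOSC.ssosc_branch (h : Q.BranchSSOSC I z p) : (Q.branch I p).SSOSC z.w z.mult := by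
  intro d hd0 hd
  rw [lagrangian_branch]
  refine h d ⟨fun i => ?_, fun i _ hi => ?_, fun i hi => ?_, fun i hi => ?_⟩ hd0
  · exact hd (.inl i) (.inl trivial)
  · have hneg : -dw (Q.g i) z.w p d = 0 := by
      simpa [branch, NLP.atParam, con, dw] using hd (.inr (.inl i)) (.inr hi)
    exact neg_eq_zero.1 hneg
  · exact hd (.inr (.inr (.inl i))) (hi.imp_right fun hi => hi.2)
  · exact hd (.inr (.inr (.inr i))) (hi.imp_right fun hi => hi.2)

/-! ### B-stationarity and S-stationarity -/

theorem BranchKKT.feasible (h : Q.BranchKKT I z p) : Q.Feasible z.w p :=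
  feasible_of_mem_feasible_branch (branchKKT_iff.1 h).feasible

theorem BranchKKT.nonneg_multipliers_iff (h : Q.BranchKKT I z p) (i : Fin m) :
    0 ≤ z.xi i ∧ 0 ≤ z.nu i ↔ 0 ≤ z.eqMultiplier I i := by
  obtain ⟨-, -, -, hI, hI'⟩ := h
  by_cases hi : i ∈ I
  · rw [z.eqMultiplier_of_mem hi, and_iff_left (hI i hi).2.2.1]
  · rw [z.eqMultiplier_of_notMem hi, and_iff_right (hI' i hi).2.2.1]

theorem BranchKKT.sStationary_iff (h : Q.BranchKKT I z p) :
    Q.SStationary z p ↔ ∀ i ∈ Q.I00 z.w p, 0 ≤ z.eqMultiplier I i := by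
  simp only [← h.nonneg_multipliers_iff]
  refine ⟨fun hS => hS.2.2.2.2.2, fun hsign => ?_⟩
  obtain ⟨hL, -, hg, hI, hI'⟩ := id h
  refine ⟨h.feasible, hL, fun i => ⟨(hg i).1, (hg i).2.2⟩, fun i hi => ?_, fun i hi => ?_, hsign⟩
  · have hiI : i ∈ I := by_contra fun hiI => hi.2.ne' (hI' i hiI).1
    exact (mul_eq_zero.1 (hI i hiI).2.2.2).resolve_right hi.2.ne'
  · have hiI : i ∉ I := fun hiI => hi.1.ne' (hI i hiI).1
    exact (mul_eq_zero.1 (hI' i hiI).2.2.2).resolve_right hi.1.ne'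

theorem SStationary.branchKKT (h : Q.SStationary z p) (hI : I ∈ Q.branches z.w p) :
    Q.BranchKKT I z p := by
  obtain ⟨hw, hL, hμ, hν, hξ, hs⟩ := h
  obtain ⟨hh, hg, hG, hH⟩ := mem_feasible_branch_iff.1 (hw.mem_branches_iff.1 hI)
  refine ⟨hL, hh, fun i => ⟨(hμ i).1, hg i, (hμ i).2⟩, fun i hi => ?_, fun i hi => ?_⟩
  · refine ⟨(hG i hi).1, (hG i hi).2, ?_⟩
    rcases (hG i hi).2.eq_or_lt with h0 | h0
    · simp [← h0, (hs i ⟨(hG i hi).1, h0.symm⟩).2]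
    · simp [hν i ⟨(hG i hi).1, h0⟩]
  · refine ⟨(hH i hi).1, (hH i hi).2, ?_⟩
    rcases (hH i hi).2.eq_or_lt with h0 | h0
    · simp [← h0, (hs i ⟨h0.symm, (hH i hi).1⟩).1]
    · simp [hξ i ⟨h0, (hH i hi).1⟩]

theorem sStationary_of_forall_branchKKT
    (h : ∀ I ∈ Q.branches z.w p, Q.BranchKKT I z p) : Q.SStationary z p := by
  refine (h _ (I0p_mem_branches z.w p)).sStationary_iff.2 fun i hi => ?_
  rw [z.eqMultiplier_of_notMem fun h => h.2.ne' hi.2]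
  exact ((h _ ⟨_, subset_rfl, rfl⟩).2.2.2.1 i (.inr hi)).2.2.1

theorem SStationary.bStationary (h : Q.SStationary z p) : Q.BStationary z.w p :=
  ⟨h.1, fun _ hI => ⟨z, rfl, h.branchKKT hI⟩⟩

theorem BranchKKT.bStationary_iff_sStationary (h : Q.BranchKKT I z p)
    (hL : (Q.branch I p).LICQ z.w) : Q.BStationary z.w p ↔ Q.SStationary z p := by
  refine ⟨fun hB => sStationary_of_forall_branchKKT fun J hJ => ?_,
    SStationary.bStationary⟩
  obtain ⟨z', hw, hz'⟩ := hB.2 J hJ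
  have hJK := branchKKT_iff.1 hz'
  rw [hw] at hJK
  have hmult : z'.mult = z.mult := (branchKKT_iff.1 h).multiplier_unique
    (Q.differentiable_branch_obj I p _) (fun k => Q.differentiable_branch_con I p k _) hL
    hJK.stationary fun k hk => hJK.eq_zero_of_con_ne_zero hk
  rwa [branchKKT_iff, ← hmult]

theorem BStationary.exists_sStationary (h : Q.BStationary w p) (hL : (Q.branch I p).LICQ w) :
    ∃ z : PrimalDual n mh mg m, z.w = w ∧ Q.SStationary z p := by
  obtain ⟨z, rfl, hz⟩ := h.2 _ (I0p_mem_branches w p)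
  exact ⟨z, rfl, (hz.bStationary_iff_sStationary hL).1 h⟩

end ParamMPCC

namespace ParamMPCC

variable {n np mh mg m : ℕ} {Q : ParamMPCC n np mh mg m} {I : Set (Fin m)} {p : Vec np}

/-! ### Persistence of stationary points -/

theorem SStationary.eventually_obj_lt {z : PrimalDual n mh mg m} (h : Q.SStationary z p)
    (hpos : ∀ d ∈ Q.strongMPCCCone z p, d ≠ 0 → 0 < Q.hessForm z p d) :
    ∀ᶠ w in 𝓝 z.w, Q.Feasible w p → w ≠ z.w → Q.f (z.w, p) < Q.f (w, p) := by
  have hbranch : ∀ I : Set (Fin m), ∀ᶠ w in 𝓝 z.w, w ∈ (Q.branch I p).feasible → w ≠ z.w →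
      Q.f (z.w, p) < Q.f (w, p) := by
    intro I
    by_cases hz : z.w ∈ (Q.branch I p).feasible
    · have hI := h.1.mem_branches_iff.2 hz
      have hS : Q.BranchSSOSC I z p := fun d hd => hpos d (mem_biUnion hI hd)
      exact (branchKKT_iff.1 (h.branchKKT hI)).eventually_obj_lt hS.ssosc_branch
        (Q.contDiff_branch_obj I p) (Q.contDiff_branch_con I p)
    · filter_upwards [((Q.isClosed_setOf_mem_feasible_branch I).preimage
        (Continuous.prodMk_left p)).isOpen_compl.mem_nhds hz] with w hw hw'
      exact absurd hw' hw
  filter_upwards [eventually_all.2 hbranch] with w hw hfeas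
  obtain ⟨I, hI⟩ := feasible_iff_exists_branch.1 hfeas
  exact hw I hI

theorem bStationary_of_isLocalMinOn {w : Vec n} (hL : ∀ I, (Q.branch I p).LICQ w)
    (hw : Q.Feasible w p) (hmin : IsLocalMinOn (fun w => Q.f (w, p)) {w | Q.Feasible w p} w) :
    Q.BStationary w p :=
  bStationary_iff.2 ⟨hw, fun I hI => (hL I).exists_isKKT_of_isLocalMinOn
    (Q.differentiable_branch_obj I p w)
    (fun k => ((Q.contDiff_branch_con I p k).of_le one_le_two).contDiffAt) hI
    (hmin.on_subset fun _ => feasible_of_mem_feasible_branch)⟩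

/-- Since `z.w` is a strict local minimizer and LICQ provides nearby feasible points for nearby
parameters, these have nearby local minimizers, which inherit LICQ. -/
theorem SStationary.eventually_exists {z : PrimalDual n mh mg m} (h : Q.SStationary z p)
    (hL : Q.MPCCLICQ z.w p)
    (hpos : ∀ d ∈ Q.strongMPCCCone z p, d ≠ 0 → 0 < Q.hessForm z p d) :
    ∀ᶠ q in 𝓝 p, ∃ z' : PrimalDual n mh mg m, Q.SStationary z' q := by
  have hLbranch := hL.licq_branch h.1
  obtain ⟨V, hV, W, hW, hVW⟩ := mem_nhds_prod_iff.1 <|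
    eventually_all.2 fun I => (hLbranch I).eventually_atParam Q.contDiff_con
  have hlsc : ∀ N ∈ 𝓝 (z.w, p), ∀ᶠ q in 𝓝 p, ∃ w, (w, q) ∈ N ∩ {u | Q.Feasible u.1 u.2} := by
    intro N hN
    filter_upwards [(hLbranch _).eventually_exists_feasible
      (fun k => ((Q.contDiff_con k).of_le one_le_two).contDiffAt)
      (h.1.mem_branches_iff.1 (I0p_mem_branches z.w p)) hN] with q ⟨w, hwN, hw⟩
    exact ⟨w, hwN, feasible_of_mem_feasible_branch hw⟩
  filter_upwards [hW, eventually_exists_isLocalMinOn Q.contDiff_f.continuous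
    Q.isClosed_setOf_feasible (h.eventually_obj_lt hpos) hlsc hV] with q hq ⟨w, hwV, hw, hmin⟩
  have hLw : ∀ I, (Q.branch I q).LICQ w := hVW (mk_mem_prod hwV hq)
  obtain ⟨z', -, hz'⟩ := (bStationary_of_isLocalMinOn hLw hw hmin).exists_sStationary (hLw ∅)
  exact ⟨z', hz'⟩

/-! ### Branch solution maps -/

namespace BranchSolutionMap

variable {U : Set (Vec np)} {zI : Vec np → PrimalDual n mh mg m}

theorem continuousAt (h : Q.BranchSolutionMap I U zI) (hU : IsOpen U) (hp : p ∈ U) :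
    ContinuousAt zI p :=
  h.1.continuousAt (hU.mem_nhds hp)

theorem pc1At (h : Q.BranchSolutionMap I U zI) (hU : IsOpen U) (hp : p ∈ U) : PC1At zI p := by
  have hpair : PC1At (fun q => ((zI q).w, (zI q).mult)) p := by
    refine NLP.pc1At_of_isKKT_of_continuousAt Q.contDiff_f Q.contDiff_con (A := branchEqs I) ?_
      (h.2 p hp).2.1.licq_branch (h.2 p hp).2.2.ssosc_branch
    filter_upwards [hU.mem_nhds hp] with q hq
    exact ⟨(PrimalDual.continuous_w.prodMk PrimalDual.continuous_mult).continuousAt.comp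
      (h.continuousAt hU hq), branchKKT_iff.1 (h.2 q hq).1⟩
  simpa using hpair.contDiff_comp PrimalDual.contDiff_ofMult

theorem bStationary_iff (h : Q.BranchSolutionMap I U zI) (hp : p ∈ U) :
    Q.BStationary (zI p).w p ↔ ∀ i ∈ Q.I00 (zI p).w p, 0 ≤ (zI p).eqMultiplier I i := by
  obtain ⟨hK, hL, -⟩ := h.2 p hp
  rw [hK.bStationary_iff_sStationary hL.licq_branch, hK.sStationary_iff]

theorem sStationary_of_signed (h : Q.BranchSolutionMap I U zI) (hp : p ∈ U) {S : Set (Vec np)}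
    {i : Fin m} (hS : Q.OtherPairsSigned i S zI) (hpS : p ∈ S)
    (hi : i ∈ Q.I00 (zI p).w p → 0 ≤ (zI p).eqMultiplier I i) : Q.SStationary (zI p) p := by
  have hK := (h.2 p hp).1
  refine hK.sStationary_iff.2 fun j hj => ?_
  by_cases hji : j = i
  · exact hji ▸ hi (hji ▸ hj)
  · exact (hK.nonneg_multipliers_iff j).1 (hS p hpS j hj hji)

end BranchSolutionMap

end ParamMPCC

/-! ### Switching between solution maps -/

theorem eventually_forall_Icc {α : Type*} [LinearOrder α] [TopologicalSpace α] [OrderTopology α]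
    {P : α → Prop} {a : α} (h : ∀ᶠ t in 𝓝 a, P t) : ∀ᶠ b in 𝓝[>] a, ∀ t ∈ Icc a b, P t :=
  (tendsto_const_nhds.Icc (tendsto_id.mono_left nhdsWithin_le_nhds)).eventually
    (eventually_smallSets_forall.2 h)

theorem not_continuousWithinAt_paramSegment {E F : Type*} [AddCommGroup E] [Module ℝ E]
    [TopologicalSpace E] [ContinuousAdd E] [ContinuousSMul ℝ E] [TopologicalSpace F] [T2Space F]
    {y z : E → F} {p v : E} {s T : ℝ} (hs : 0 < s) (hT : s ≤ T) (hy : ContinuousAt y (p + s • v))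
    (hz : ∀ τ ∈ Ico 0 s, z (p + τ • v) = y (p + τ • v)) (hne : z (p + s • v) ≠ y (p + s • v)) :
    ¬ ContinuousWithinAt z (paramSegment p v T) (p + s • v) := by
  intro hc
  have hline : Tendsto (fun τ : ℝ => p + τ • v) (𝓝[<] s) (𝓝 (p + s • v)) :=
    ((by fun_prop : Continuous fun τ : ℝ => p + τ • v).tendsto s).mono_left nhdsWithin_le_nhds
  have hIco : ∀ᶠ τ in 𝓝[<] s, τ ∈ Ico 0 s := Ico_mem_nhdsLT hs
  have hsegment : ∀ᶠ τ in 𝓝[<] s, p + τ • v ∈ paramSegment p v T :=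
    hIco.mono fun τ hτ => ⟨τ, ⟨hτ.1, hτ.2.le.trans hT⟩, rfl⟩
  refine hne (tendsto_nhds_unique (hc.tendsto.comp (tendsto_nhdsWithin_iff.2 ⟨hline, hsegment⟩)) ?_)
  exact (hy.tendsto.comp hline).congr' (hIco.mono fun τ hτ => (hz τ hτ).symm)

namespace ParamMPCC

variable {n np mh mg m : ℕ} {Q : ParamMPCC n np mh mg m} {I : Set (Fin m)} {U : Set (Vec np)}
  {zI : Vec np → PrimalDual n mh mg m} {pbar v : Vec np} {i : Fin m} {τs τ T : ℝ}

/-- On the segment from `pbar` to `pbar + v`, the solution map `zI` of the branch problem `I` is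
such that the pair `i` is nondegenerate before the parameter `pbar + τs • v` and degenerate from
there on. -/
structure BranchSwitch (Q : ParamMPCC n np mh mg m) (I : Set (Fin m)) (U : Set (Vec np))
    (zI : Vec np → PrimalDual n mh mg m) (pbar v : Vec np) (i : Fin m) (τs : ℝ) : Prop where
  isOpen : IsOpen U
  segment_subset : paramSegment pbar v 1 ⊆ U
  solutionMap : Q.BranchSolutionMap I U zI
  mem_Ioo : τs ∈ Ioo (0 : ℝ) 1
  notMem_I00 : ∀ τ ∈ Ico 0 τs, i ∉ Q.I00 (zI (pbar + τ • v)).w (pbar + τ • v)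
  mem_I00 : ∀ τ ∈ Icc τs 1, i ∈ Q.I00 (zI (pbar + τ • v)).w (pbar + τ • v)

namespace BranchSwitch

theorem param_mem (h : Q.BranchSwitch I U zI pbar v i τs) (hτ : τ ∈ Icc (0 : ℝ) 1) :
    pbar + τ • v ∈ U :=
  h.segment_subset ⟨τ, hτ, rfl⟩

theorem param_injective (h : Q.BranchSwitch I U zI pbar v i τs) :
    Function.Injective fun τ : ℝ => pbar + τ • v := by
  have hv : v ≠ 0 := by
    rintro rfl
    have hbefore := h.notMem_I00 0 ⟨le_rfl, h.mem_Ioo.1⟩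
    have hafter := h.mem_I00 τs ⟨le_rfl, h.mem_Ioo.2.le⟩
    simp only [smul_zero] at hbefore hafter
    exact hbefore hafter
  exact (add_right_injective pbar).comp (smul_left_injective ℝ hv)

theorem continuousAt (h : Q.BranchSwitch I U zI pbar v i τs) : ContinuousAt zI (pbar + τs • v) :=
  h.solutionMap.continuousAt h.isOpen (h.param_mem ⟨h.mem_Ioo.1.le, h.mem_Ioo.2.le⟩)

theorem tendsto_eqMultiplier (h : Q.BranchSwitch I U zI pbar v i τs) :
    Tendsto (fun τ : ℝ => (zI (pbar + τ • v)).eqMultiplier I i) (𝓝 τs)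
      (𝓝 ((zI (pbar + τs • v)).eqMultiplier I i)) :=
  ((PrimalDual.continuous_eqMultiplier I i).continuousAt.comp h.continuousAt).tendsto.comp
    ((by fun_prop : Continuous fun τ : ℝ => pbar + τ • v).tendsto τs)

theorem eventually_le_one (h : Q.BranchSwitch I U zI pbar v i τs) : ∀ᶠ T in 𝓝[>] τs, T ≤ 1 :=
  (eventually_le_nhds h.mem_Ioo.2).filter_mono nhdsWithin_le_nhds

theorem sStationary (h : Q.BranchSwitch I U zI pbar v i τs) (hτ : τ ∈ Icc (0 : ℝ) 1)
    {S : Set (Vec np)} (hS : Q.OtherPairsSigned i S zI) (hτS : pbar + τ • v ∈ S)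
    (hmult : τs ≤ τ → 0 ≤ (zI (pbar + τ • v)).eqMultiplier I i) :
    Q.SStationary (zI (pbar + τ • v)) (pbar + τ • v) :=
  h.solutionMap.sStationary_of_signed (h.param_mem hτ) hS hτS fun hi =>
    hmult (not_lt.1 fun hlt => h.notMem_I00 τ ⟨hτ.1, hlt⟩ hi)

theorem pc1At_and_bStationary (h : Q.BranchSwitch I U zI pbar v i τs) (hT : T ≤ 1)
    (hS : Q.OtherPairsSigned i (paramSegment pbar v T) zI)
    (hmult : ∀ τ ∈ Icc τs T, 0 ≤ (zI (pbar + τ • v)).eqMultiplier I i) :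
    ∀ p ∈ paramSegment pbar v T, PC1At zI p ∧ Q.BStationary (zI p).w p := by
  rintro p ⟨τ, hτ, rfl⟩
  have hτ1 : τ ∈ Icc (0 : ℝ) 1 := ⟨hτ.1, hτ.2.trans hT⟩
  exact ⟨h.solutionMap.pc1At h.isOpen (h.param_mem hτ1),
    (h.sStationary hτ1 hS ⟨τ, hτ, rfl⟩ fun hle => hmult τ ⟨hle, hτ.2⟩).bStationary⟩

theorem eventually_pc1At_and_bStationary (h : Q.BranchSwitch I U zI pbar v i τs)
    (hS : Q.OtherPairsSigned i (paramSegment pbar v 1) zI)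
    (hpos : 0 < (zI (pbar + τs • v)).eqMultiplier I i) :
    ∀ᶠ T in 𝓝[>] τs, ∀ p ∈ paramSegment pbar v T, PC1At zI p ∧ Q.BStationary (zI p).w p := by
  filter_upwards [h.eventually_le_one,
    eventually_forall_Icc (h.tendsto_eqMultiplier.eventually_const_le hpos)] with T hT hmult
  exact h.pc1At_and_bStationary hT
    (fun p hp => hS p (image_mono (Icc_subset_Icc_right hT) hp)) hmult

theorem not_bStationary (h : Q.BranchSwitch I U zI pbar v i τs) (hτ : τ ∈ Icc τs 1)
    (hneg : (zI (pbar + τ • v)).eqMultiplier I i < 0) :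
    ¬ Q.BStationary (zI (pbar + τ • v)).w (pbar + τ • v) := fun hB =>
  hneg.not_ge <| (h.solutionMap.bStationary_iff
    (h.param_mem ⟨h.mem_Ioo.1.le.trans hτ.1, hτ.2⟩)).1 hB i (h.mem_I00 τ hτ)

theorem eventually_not_bStationary (h : Q.BranchSwitch I U zI pbar v i τs)
    (hneg : (zI (pbar + τs • v)).eqMultiplier I i < 0) :
    ∀ᶠ T in 𝓝[>] τs, ∀ τ ∈ Icc τs T, ¬ Q.BStationary (zI (pbar + τ • v)).w (pbar + τ • v) := by
  filter_upwards [h.eventually_le_one,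
    eventually_forall_Icc (h.tendsto_eqMultiplier.eventually_lt_const hneg)] with T hT hmult τ hτ
  exact h.not_bStationary ⟨hτ.1, hτ.2.trans hT⟩ (hmult τ hτ)

theorem exists_sStationary_extension (h : Q.BranchSwitch I U zI pbar v i τs)
    (hS : Q.OtherPairsSigned i ((fun τ : ℝ => pbar + τ • v) '' Ico 0 τs) zI)
    {zhat : PrimalDual n mh mg m} (hzhat : Q.SStationary zhat (pbar + τs • v))
    (hT : ∀ τ ∈ Icc τs T, ∃ z : PrimalDual n mh mg m, Q.SStationary z (pbar + τ • v)) :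
    ∃ z : Vec np → PrimalDual n mh mg m,
      (∀ p ∈ paramSegment pbar v T, Q.SStationary (z p) p) ∧
      (∀ τ ∈ Ico 0 τs, z (pbar + τ • v) = zI (pbar + τ • v)) ∧ z (pbar + τs • v) = zhat := by
  choose! y hy using hT
  let ζ : ℝ → PrimalDual n mh mg m := fun τ =>
    if τ < τs then zI (pbar + τ • v) else if τ = τs then zhat else y τ
  have hz : ∀ τ : ℝ, (fun τ : ℝ => pbar + τ • v).extend ζ (fun _ => zhat) (pbar + τ • v) = ζ τ :=
    h.param_injective.extend_apply ζ _
  refine ⟨(fun τ : ℝ => pbar + τ • v).extend ζ fun _ => zhat, ?_, fun τ hτ => ?_, ?_⟩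
  · rintro p ⟨τ, hτ, rfl⟩
    simp only [hz, ζ]
    split_ifs with hlt heq
    · exact h.sStationary ⟨hτ.1, hlt.le.trans h.mem_Ioo.2.le⟩ hS ⟨τ, ⟨hτ.1, hlt⟩, rfl⟩
        fun hle => absurd hlt hle.not_gt
    · exact heq ▸ hzhat
    · exact hy τ ⟨not_lt.1 hlt, hτ.2⟩
  · rw [hz]
    exact if_pos hτ.2
  · simp [hz, ζ]

theorem eventually_exists_discontinuous (h : Q.BranchSwitch I U zI pbar v i τs)
    (hneg : (zI (pbar + τs • v)).eqMultiplier I i < 0)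
    (hS : Q.OtherPairsSigned i ((fun τ : ℝ => pbar + τ • v) '' Ico 0 τs) zI) {what : Vec n}
    (hL : Q.MPCCLICQ what (pbar + τs • v)) (hSSOSC : Q.MPCCSSOSC what (pbar + τs • v)) :
    ∀ᶠ T in 𝓝[>] τs, ∃ z : Vec np → PrimalDual n mh mg m,
      (∀ p ∈ paramSegment pbar v T, Q.BStationary (z p).w p ∧ Q.SStationary (z p) p) ∧
      (∀ τ ∈ Ico 0 τs, z (pbar + τ • v) = zI (pbar + τ • v)) ∧
      (z (pbar + τs • v)).w = what ∧
      ¬ ContinuousWithinAt z (paramSegment pbar v T) (pbar + τs • v) ∧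
      ¬ ContinuousWithinAt (fun p => (z p).w) (paramSegment pbar v T) (pbar + τs • v) := by
  obtain ⟨zhat, rfl, hzhat, hpos⟩ := hSSOSC
  have hne : zhat.w ≠ (zI (pbar + τs • v)).w := fun heq =>
    h.not_bStationary ⟨le_rfl, h.mem_Ioo.2.le⟩ hneg (heq ▸ hzhat.bStationary)
  have hline : Continuous fun τ : ℝ => pbar + τ • v := by fun_prop
  filter_upwards [self_mem_nhdsWithin, eventually_forall_Icc
    ((hline.tendsto τs).eventually (hzhat.eventually_exists hL hpos))] with T hτsT hT
  obtain ⟨z, hzS, hzI, hzs⟩ := h.exists_sStationary_extension hS hzhat hT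
  have hdisc : ¬ ContinuousWithinAt (fun p => (z p).w) (paramSegment pbar v T) (pbar + τs • v) :=
    not_continuousWithinAt_paramSegment h.mem_Ioo.1 (le_of_lt hτsT)
      (PrimalDual.continuous_w.continuousAt.comp h.continuousAt)
      (fun τ hτ => congrArg PrimalDual.w (hzI τ hτ)) (by simpa [hzs] using hne)
  exact ⟨z, fun p hp => ⟨(hzS p hp).bStationary, hzS p hp⟩, hzI, by rw [hzs],
    fun hc => hdisc (PrimalDual.continuous_w.continuousAt.comp_continuousWithinAt hc), hdisc⟩

theorem eventually_xor (h : Q.BranchSwitch I U zI pbar v i τs)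
    (hS : Q.OtherPairsSigned i (paramSegment pbar v 1) zI)
    (hne : (zI (pbar + τs • v)).eqMultiplier I i ≠ 0) :
    ∀ᶠ T in 𝓝[>] τs, Xor (∀ p ∈ paramSegment pbar v T, PC1At zI p ∧ Q.BStationary (zI p).w p)
      (∀ τ ∈ Icc τs T, ¬ Q.BStationary (zI (pbar + τ • v)).w (pbar + τ • v)) := by
  have hexcl : ∀ᶠ T in 𝓝[>] τs,
      (∀ p ∈ paramSegment pbar v T, PC1At zI p ∧ Q.BStationary (zI p).w p) →
        ¬ ∀ τ ∈ Icc τs T, ¬ Q.BStationary (zI (pbar + τ • v)).w (pbar + τ • v) := by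
    filter_upwards [self_mem_nhdsWithin] with T hT hgood hbad
    exact hbad τs ⟨le_rfl, le_of_lt hT⟩ (hgood _ ⟨τs, ⟨h.mem_Ioo.1.le, le_of_lt hT⟩, rfl⟩).2
  rcases hne.lt_or_gt with hneg | hpos
  · filter_upwards [h.eventually_not_bStationary hneg, hexcl] with T hT hexcl
    exact .inr ⟨hT, fun hgood => hexcl hgood hT⟩
  · filter_upwards [h.eventually_pc1At_and_bStationary hS hpos, hexcl] with T hT hexcl
    exact .inl ⟨hT, hexcl hT⟩

end BranchSwitch

end ParamMPCC

theorem mainTheorem2_general {n np mh mg m : ℕ} {Q : ParamMPCC n np mh mg m} {I : Set (Fin m)}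
    {U : Set (Vec np)} {zI : Vec np → PrimalDual n mh mg m} {pbar v : Vec np} {i : Fin m} {τs : ℝ}
    (h : Q.BranchSwitch I U zI pbar v i τs) :
    (Q.OtherPairsSigned i (paramSegment pbar v 1) zI →
      (∀ τ ∈ Icc τs 1, 0 ≤ (zI (pbar + τ • v)).eqMultiplier I i) →
        ∀ p ∈ paramSegment pbar v 1, PC1At zI p ∧ Q.BStationary (zI p).w p) ∧
    ((zI (pbar + τs • v)).eqMultiplier I i < 0 →
      (∀ τ ∈ Icc τs 1, (zI (pbar + τ • v)).eqMultiplier I i < 0 →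
        ¬ Q.BStationary (zI (pbar + τ • v)).w (pbar + τ • v)) ∧
      (∀ᶠ T in 𝓝[>] τs, ∀ τ ∈ Icc τs T,
        ¬ Q.BStationary (zI (pbar + τ • v)).w (pbar + τ • v)) ∧
      (Q.OtherPairsSigned i ((fun τ : ℝ => pbar + τ • v) '' Ico 0 τs) zI →
        ∀ what : Vec n, Q.MPCCLICQ what (pbar + τs • v) → Q.MPCCSSOSC what (pbar + τs • v) →
          ∀ᶠ T in 𝓝[>] τs, ∃ z : Vec np → PrimalDual n mh mg m,
            (∀ p ∈ paramSegment pbar v T, Q.BStationary (z p).w p ∧ Q.SStationary (z p) p) ∧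
            (∀ τ ∈ Ico 0 τs, z (pbar + τ • v) = zI (pbar + τ • v)) ∧
            (z (pbar + τs • v)).w = what ∧
            ¬ ContinuousWithinAt z (paramSegment pbar v T) (pbar + τs • v) ∧
            ¬ ContinuousWithinAt (fun p => (z p).w) (paramSegment pbar v T)
              (pbar + τs • v))) ∧
    (Q.OtherPairsSigned i (paramSegment pbar v 1) zI →
      (zI (pbar + τs • v)).eqMultiplier I i ≠ 0 →
        ∀ᶠ T in 𝓝[>] τs,
          Xor (∀ p ∈ paramSegment pbar v T, PC1At zI p ∧ Q.BStationary (zI p).w p)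
            (∀ τ ∈ Icc τs T, ¬ Q.BStationary (zI (pbar + τ • v)).w (pbar + τ • v))) :=
  ⟨h.pc1At_and_bStationary le_rfl,
    fun hneg => ⟨fun _ => h.not_bStationary, h.eventually_not_bStationary hneg,
      fun hS _ => h.eventually_exists_discontinuous hneg hS⟩,
    h.eventually_xor⟩

theorem mainTheorem2 {n np mh mg m : ℕ} (Q : ParamMPCC n np mh mg m)
    (wbar : Vec n) (pbar : Vec np)
    (hB : Q.BStationary wbar pbar) (hLICQ : Q.MPCCLICQ wbar pbar)
    (hSSOSC : Q.MPCCSSOSC wbar pbar)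
    -- the branch solution map, on a neighborhood that contains the parameter segment
    (v : Vec np) (I : Set (Fin m)) (hI : I ∈ Q.branches wbar pbar)
    (U : Set (Vec np)) (hU : IsOpen U) (hSU : paramSegment pbar v 1 ⊆ U)
    (zI : Vec np → PrimalDual n mh mg m) (hzI : Q.BranchSolutionMap I U zI)
    (hzbar : (zI pbar).w = wbar)
    -- the switching index, its multiplier, and the switching parameter
    (i : Fin m) (θ : Vec np → ℝ)
    (hθ : (i ∈ Q.I0p wbar pbar ∧ θ = fun p => (zI p).xi i) ∨
      (i ∈ Q.Ip0 wbar pbar ∧ θ = fun p => (zI p).nu i))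
    (τs : ℝ) (hτs : τs ∈ Set.Ioo (0 : ℝ) 1)
    (hbefore : ∀ τ ∈ Set.Ico 0 τs, i ∉ Q.I00 (zI (pbar + τ • v)).w (pbar + τ • v))
    (hafter : ∀ τ ∈ Set.Icc τs 1, i ∈ Q.I00 (zI (pbar + τ • v)).w (pbar + τ • v)) :
    -- (a)
    (Q.OtherPairsSigned i (paramSegment pbar v 1) zI →
      (∀ τ ∈ Set.Icc τs 1, 0 ≤ θ (pbar + τ • v)) →
        ∀ p ∈ paramSegment pbar v 1, PC1At zI p ∧ Q.BStationary (zI p).w p) ∧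
    -- (b)
    (θ (pbar + τs • v) < 0 →
      (∀ τ ∈ Set.Icc τs 1, θ (pbar + τ • v) < 0 →
        ¬ Q.BStationary (zI (pbar + τ • v)).w (pbar + τ • v)) ∧
      (∀ᶠ T in 𝓝[>] τs, ∀ τ ∈ Set.Icc τs T,
        ¬ Q.BStationary (zI (pbar + τ • v)).w (pbar + τ • v)) ∧
      (Q.OtherPairsSigned i ((fun τ : ℝ => pbar + τ • v) '' Set.Ico 0 τs) zI →
        ∀ what : Vec n, Q.BStationary what (pbar + τs • v) →
          Q.MPCCLICQ what (pbar + τs • v) → Q.MPCCSSOSC what (pbar + τs • v) →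
          ∀ᶠ T in 𝓝[>] τs, ∃ z : Vec np → PrimalDual n mh mg m,
            (∀ p ∈ paramSegment pbar v T, Q.BStationary (z p).w p ∧ Q.SStationary (z p) p) ∧
            (∀ τ ∈ Set.Ico 0 τs, z (pbar + τ • v) = zI (pbar + τ • v)) ∧
            (z (pbar + τs • v)).w = what ∧
            ¬ ContinuousWithinAt z (paramSegment pbar v T) (pbar + τs • v) ∧
            ¬ ContinuousWithinAt (fun p => (z p).w) (paramSegment pbar v T)
              (pbar + τs • v))) ∧
    -- exactly one of the two alternatives
    (Q.OtherPairsSigned i (paramSegment pbar v 1) zI → θ (pbar + τs • v) ≠ 0 →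
      ∀ᶠ T in 𝓝[>] τs,
        Xor (∀ p ∈ paramSegment pbar v T, PC1At zI p ∧ Q.BStationary (zI p).w p)
          (∀ τ ∈ Set.Icc τs T,
            ¬ Q.BStationary (zI (pbar + τ • v)).w (pbar + τ • v))) := by
  obtain rfl : θ = fun p => (zI p).eqMultiplier I i := by
    rcases hθ with ⟨hi, rfl⟩ | ⟨hi, rfl⟩
    · exact funext fun p => ((zI p).eqMultiplier_of_mem (ParamMPCC.mem_of_mem_I0p hI hi)).symm
    · exact funext fun p => ((zI p).eqMultiplier_of_notMem (ParamMPCC.notMem_of_mem_Ip0 hI hi)).symm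
  obtain ⟨ha, hb, hxor⟩ := mainTheorem2_general ⟨hU, hSU, hzI, hτs, hbefore, hafter⟩
  exact ⟨ha, fun hneg => (hb hneg).imp_right (And.imp_right fun hdisc hS what _ => hdisc hS what),
    hxor⟩
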